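/- Let $\Phi:\mathbb{R}^d\to\mathbb{R}$ be continuously differentiable with $\int_{\mathbb{R}^d} e^{-\Phi(y)}\,dy<\infty$, and let $\Pi$ be the probability measure on $\mathbb{R}^d$ with density proportional to $e^{-\Phi}$. Let $\gamma>0$, $T\ge h>0$, $L=\lfloor T/h\rfloor$ and $\eta=e^{-\gamma h/2}$. For $(x_0,v_0)\in\mathbb{R}^{2d}$ let $\mathbf{Q}_{h,\gamma}((x_0,v_0),\cdot)$ be the law of the pair $(x_1,v_1)$ given by $$v_0'=\eta v_0+\sqrt{1-\eta^2}\,\xi,\quad v_{1/2}=v_0'-\tfrac h2\nabla\Phi(x_0),\quad x_1=x_0+h v_{1/2},\quad v_1'=v_{1/2}-\tfrac h2\nabla\Phi(x_1),\quad v_1=\eta v_1'+\sqrt{1-\eta^2}\,\xi',$$ where $\xi,\xi'$ are independent standard Gaussian vectors of $\mathbb{R}^d$. Put $$\mathcal{E}_h(x,y)=\Phi(y)-\Phi(x)-\tfrac12 (y-x)^\top(\nabla\Phi(y)+\nabla\Phi(x))+\tfrac{h^2}{8}\left(|\nabla\Phi(y)|^2-|\nabla\Phi(x)|^2\right).$$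 The MALT (Metropolis Adjusted Langevin Trajectories) kernel $\mathbf{P}$ on $\mathbb{R}^d$ is defined by the following transition from $x$: draw $v_0$ from the standard Gaussian distribution on $\mathbb{R}^d$, set $x_0=x$, draw successively $(x_i,v_i)\sim\mathbf{Q}_{h,\gamma}((x_{i-1},v_{i-1}),\cdot)$ for $i=1,\dots,L$, set $\Delta=\sum_{i=1}^L\mathcal{E}_h(x_{i-1},x_i)$, and move to $x_L$ with probability $\min(1,e^{-\Delta})$; otherwise stay at $x$. Then: 1. $\mathbf{P}$ is $\Pi$-irreducible: for every Borel set $A$ with $\Pi(A)>0$ and every $x\in\mathbb{R}^d$ there is an integer $n\ge1$ with $\mathbf{P}^n(x,A)>0$. 2. $\mathbf{P}$ is aperiodic: there are no integer $p\ge2$ and pairwise disjoint Borel sets $S_0,\dots,S_{p-1}$ with $\Pi(S_0)>0$ such that $\mathbf{P}(x,S_{(i+1)\bmod p})=1$ for all $i$ and all $x\in S_i$. 3. For $\Pi$-almost every $x\in\mathbb{R}^d$, $$\lim_{n\to\infty}\left\|\delta_x\mathbf{P}^n-\Pi\right\|_{\rm TV}=0,\qquad\text{where }\|\nu-\nu'\|_{\rm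 TV}=\sup\{|\nu(A)-\nu'(A)|: A\subseteq\mathbb{R}^d\text{ Borel}\}.$$ -/

import Mathlib

open MeasureTheory ProbabilityTheory Filter Topology

namespace MALT

/-- The space `ℝ^d` with its Euclidean norm. -/
abbrev E (d : ℕ) : Type := EuclideanSpace ℝ (Fin d)

/-- The probability measure on `ℝ^d` with density proportional to `exp (-Φ)`. -/
noncomputable def target {d : ℕ} (Φ : E d → ℝ) : Measure (E d) :=
  (∫⁻ x, ENNReal.ofReal (Real.exp (-Φ x)))⁻¹ •
    (volume : Measure (E d)).withDensity (fun x => ENNReal.ofReal (Real.exp (-Φ x)))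

/-- One OBABO step of the discretized Langevin dynamics with potential `Φ`, time-step `h` and
friction `γ`, started at `z = (x₀, v₀)` and driven by the Gaussian draws `ξ = (ξ₁, ξ₂)`. -/
noncomputable def obabo {d : ℕ} (Φ : E d → ℝ) (h γ : ℝ) (z ξ : E d × E d) : E d × E d :=
  let η : ℝ := Real.exp (-(γ * h / 2))
  let v₀' : E d := η • z.2 + √(1 - η ^ 2) • ξ.1
  let vHalf : E d := v₀' - (h / 2) • gradient Φ z.1
  let x₁ : E d := z.1 + h • vHalf
  let v₁' : E d := vHalf - (h / 2) • gradient Φ x₁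
  (x₁, η • v₁' + √(1 - η ^ 2) • ξ.2)

/-- The OBABO Markov kernel on `ℝ^{2d}`: the law of one OBABO step driven by two independent
standard Gaussian vectors. -/
noncomputable def obaboKernel {d : ℕ} (Φ : E d → ℝ) (h γ : ℝ) :
    Kernel (E d × E d) (E d × E d) :=
  (Kernel.id ×ₖ Kernel.const (E d × E d) ((stdGaussian (E d)).prod (stdGaussian (E d)))).map
    (fun p => obabo Φ h γ p.1 p.2)

/-- The local energy error of a step from position `x` to position `y`. -/
noncomputable def localError {d : ℕ} (Φ : E d → ℝ) (h : ℝ) (x y : E d) : ℝ :=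
  Φ y - Φ x - (1 / 2) * inner ℝ (y - x) (gradient Φ y + gradient Φ x)
    + h ^ 2 / 8 * (‖gradient Φ y‖ ^ 2 - ‖gradient Φ x‖ ^ 2)

/-- One pass of the inner loop of the algorithm: from `((x, v), Δ)`, draw `(x', v')` from the
OBABO kernel at `(x, v)` and increase `Δ` by the local error of the step from `x` to `x'`. -/
noncomputable def stepKernel {d : ℕ} (Φ : E d → ℝ) (h γ : ℝ) :
    Kernel ((E d × E d) × ℝ) ((E d × E d) × ℝ) :=
  (Kernel.id ×ₖ (obaboKernel Φ h γ).comap Prod.fst measurable_fst).map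
    (fun p => (p.2, p.1.2 + localError Φ h p.1.1.1 p.2.1))

/-- The law, given the position `x`, of the end point of the proposed Langevin trajectory together
with its total energy error: draw a standard Gaussian velocity `v`, start from `((x, v), 0)`, and
make `L` steps. -/
noncomputable def proposalKernel {d : ℕ} (Φ : E d → ℝ) (h γ : ℝ) (L : ℕ) :
    Kernel (E d) ((E d × E d) × ℝ) :=
  (stepKernel Φ h γ ^ L) ∘ₖ
    (Kernel.id ×ₖ Kernel.const (E d) (stdGaussian (E d))).map (fun z => (z, (0 : ℝ)))

/-- The acceptance probability `1 ∧ exp (-Δ)`. -/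
noncomputable def acceptProb (Δ : ℝ) : ℝ := min 1 (Real.exp (-Δ))

/-- The accept-reject test: given the current position `x` and the result `((y, v), Δ)` of the
proposal, move to `y` with probability `1 ∧ exp (-Δ)` and stay at `x` otherwise. -/
noncomputable def acceptKernel (d : ℕ) : Kernel (E d × ((E d × E d) × ℝ)) (E d) where
  toFun p := ENNReal.ofReal (acceptProb p.2.2) • Measure.dirac p.2.1.1
    + ENNReal.ofReal (1 - acceptProb p.2.2) • Measure.dirac p.1
  measurable' := by
    have ha : Measurable acceptProb := by unfold acceptProb; fun_prop
    refine Measure.measurable_of_measurable_coe _ fun s hs => ?_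
    simp only [Measure.coe_add, Measure.coe_smul, Pi.add_apply, Pi.smul_apply, smul_eq_mul,
      Measure.dirac_apply' _ hs]
    have h1 : Measurable (s.indicator (1 : E d → ENNReal)) := measurable_one.indicator hs
    fun_prop

/-- The Markov kernel on `ℝ^d` of the positions of the Metropolis adjusted Langevin trajectories
algorithm with time-step `h`, integration time `T` (so `⌊T / h⌋` steps per trajectory) and
friction `γ`. -/
noncomputable def maltKernel {d : ℕ} (Φ : E d → ℝ) (h T γ : ℝ) : Kernel (E d) (E d) :=
  acceptKernel d ∘ₖ (Kernel.id ×ₖ proposalKernel Φ h γ ⌊T / h⌋₊)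

/-- `φ`-irreducibility: every set of positive `φ`-measure is reached with positive probability
from every point in some positive number of steps (Mathlib's `Kernel.IsIrreducible` also allows
zero steps). -/
def IsIrreducible {α : Type*} [MeasurableSpace α] (φ : Measure α) (κ : Kernel α α) : Prop :=
  ∀ A : Set α, MeasurableSet A → 0 < φ A → ∀ x : α, ∃ n : ℕ, 0 < n ∧ 0 < (κ ^ n) x A

/-- Aperiodicity of a kernel with stationary measure `π`: there are no `p ≥ 2` and disjoint
measurable sets `S 0, …, S (p - 1)`, with `S 0` of positive `π`-measure, which the chain visits
cyclically with probability one. -/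
def IsAperiodic {α : Type*} [MeasurableSpace α] (π : Measure α) (κ : Kernel α α) : Prop :=
  ¬ ∃ p : ℕ, 2 ≤ p ∧ ∃ S : ZMod p → Set α,
    (∀ i, MeasurableSet (S i)) ∧ Pairwise (fun i j => Disjoint (S i) (S j)) ∧
    (∀ i, ∀ x ∈ S i, κ x (S (i + 1)) = 1) ∧ 0 < π (S 0)

/-- The total variation distance `sup_A |μ A - ν A|` between two finite measures, where `A` runs
over the measurable sets. -/
noncomputable def tvDist {α : Type*} [MeasurableSpace α] (μ ν : Measure α) : ℝ :=
  ⨆ A : {A : Set α // MeasurableSet A}, |μ.real A.1 - ν.real A.1|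

end MALT

/-! Two facts about the kernel carry everything. First, it is reversible with respect to the target.
Second, from every `x` its law is `r • dirac x + ν`, where `r < 1` and `ν` has the same null sets as
Lebesgue measure: the last position of the trajectory is a nondegenerate affine image of a Gaussian
vector, and acceptance probabilities are positive. Hence every transition law dominates the target,
and irreducibility (in one step) and aperiodicity follow at once.

For convergence, reversibility makes the kernel a self-adjoint contraction `S` of `L²(π)`, whose
even powers converge strongly to fixed points of `S²`. Domination forces these fixed points to be
constant, so `S ^ n u` tends to the mean of `u` (`tendsto_opLp_pow`). Pairing with indicators gives
total variation convergence from every initial law with a density, uniformly over sets. From a point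
`x`, conditioning on the first step gives `u (n + 1) ≤ r * u n + o(1)` for the distance `u n`, hence
`u n → 0` (`tendsto_tvDist_pow`).

Reversibility comes from time reversal. Leapfrog preserves volume, is inverted by flipping
velocities, and changes the energy by exactly the local error; the Gaussian refreshments are
reversible. So, up to velocity flips, the accumulated error `Δ` of a trajectory is the log-ratio of
the laws of the forward and backward trajectories (`lintegral_trajectory_reversal`), which is what
the Metropolis test corrects. -/

namespace MALT

/-! ### Powers of self-adjoint contractions -/

/-- The even powers of a self-adjoint contraction converge strongly to fixed points of its
square. -/
theorem exists_tendsto_even_pow_of_symmetric {H : Type*} [NormedAddCommGroup H]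
    [InnerProductSpace ℝ H] [CompleteSpace H] (S : H →L[ℝ] H)
    (hsymm : ∀ u w, inner ℝ (S u) w = inner ℝ u (S w)) (hcontr : ∀ u, ‖S u‖ ≤ ‖u‖) (u : H) :
    ∃ g, Tendsto (fun n : ℕ => (S ^ (2 * n)) u) atTop (𝓝 g) ∧ S (S g) = g := by
  have hpow : ∀ n (a b : H), inner ℝ ((S ^ n) a) b = inner ℝ a ((S ^ n) b) := by
    intro n
    induction n with
    | zero => simp
    | succ n ih =>
      intro a b
      rw [pow_succ, mul_apply_eq_comp, ih, hsymm, ← mul_apply_eq_comp,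
        ← pow_succ', pow_succ]
  have hadd : ∀ m k (a : H), (S ^ m) ((S ^ k) a) = (S ^ (m + k)) a := by
    intro m k a
    rw [pow_add, mul_apply_eq_comp]
  set b : ℕ → ℝ := fun n => inner ℝ u ((S ^ (2 * n)) u) with hb
  have hbn : ∀ n, b n = ‖(S ^ n) u‖ ^ 2 := by
    intro n
    simp only [hb]
    rw [← real_inner_self_eq_norm_sq, hpow, hadd, two_mul]
  have hanti : Antitone b := by
    refine antitone_nat_of_succ_le fun n => ?_
    rw [hbn, hbn, pow_succ' S, mul_apply_eq_comp]
    gcongr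
    exact hcontr _
  have hbdd : BddBelow (Set.range b) := ⟨0, by rintro _ ⟨n, rfl⟩; rw [hbn]; positivity⟩
  have hlim := tendsto_atTop_ciInf hanti hbdd
  set c := ⨅ n, b n
  -- Even exponents make the cross term a value of `b` too, so convergence of the monotone sequence
  -- `b` controls the distances.
  have hdist : ∀ m k, ‖(S ^ (2 * m)) u - (S ^ (2 * k)) u‖ ^ 2
      = b (2 * m) + b (2 * k) - 2 * b (m + k) := by
    intro m k
    rw [norm_sub_sq_real, ← hbn, ← hbn, hpow, hadd, hb]
    ring_nf
  have hcauchy : CauchySeq (fun n : ℕ => (S ^ (2 * n)) u) := by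
    rw [Metric.cauchySeq_iff]
    intro ε hε
    -- The three values of `b` enter with total weight `1 + 1 + 2`, hence the quarter.
    obtain ⟨N, hN⟩ := (Metric.tendsto_atTop.1 hlim) (ε ^ 2 / 4) (by positivity)
    refine ⟨N, fun m hm k hk => ?_⟩
    rw [dist_eq_norm]
    refine lt_of_pow_lt_pow_left₀ 2 hε.le ?_
    rw [hdist]
    have h1 := abs_lt.1 (hN (2 * m) (by omega))
    have h2 := abs_lt.1 (hN (2 * k) (by omega))
    have h3 := abs_lt.1 (hN (m + k) (by omega))
    linarith [h1.2, h2.2, h3.1]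
  obtain ⟨g, hg⟩ := cauchySeq_tendsto_of_complete hcauchy
  refine ⟨g, hg, ?_⟩
  have h1 := (hg.comp (tendsto_add_atTop_nat 1))
  have h2 : Tendsto (fun n : ℕ => S (S ((S ^ (2 * n)) u))) atTop (𝓝 (S (S g))) :=
    ((S.continuous.comp S.continuous).tendsto g).comp hg
  refine tendsto_nhds_unique (h2.congr fun n => ?_) h1
  simp only [Function.comp]
  rw [mul_add, mul_one, add_comm, ← hadd, pow_two, mul_apply_eq_comp]

/-! ### The `L²` operator of a reversible kernel -/

section Reversible

variable {α : Type*} [MeasurableSpace α]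

/-- Reversibility of a kernel, as symmetry of the law of two successive states. -/
def SymmetricPair (π : Measure α) (κ : Kernel α α) : Prop :=
  (π ⊗ₘ κ).map Prod.swap = π ⊗ₘ κ

variable {π : Measure α} [IsProbabilityMeasure π] {κ : Kernel α α} [IsMarkovKernel κ]

theorem measurePreserving_fst_compProd : MeasurePreserving Prod.fst (π ⊗ₘ κ) π :=
  ⟨measurable_fst, Measure.fst_compProd π κ⟩

omit [IsProbabilityMeasure π] [IsMarkovKernel κ] in
theorem SymmetricPair.measurePreserving_swap (h : SymmetricPair π κ) :
    MeasurePreserving Prod.swap (π ⊗ₘ κ) (π ⊗ₘ κ) := ⟨measurable_swap, h⟩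

theorem SymmetricPair.measurePreserving_snd (h : SymmetricPair π κ) :
    MeasurePreserving Prod.snd (π ⊗ₘ κ) π :=
  (measurePreserving_fst_compProd (κ := κ)).comp h.measurePreserving_swap

instance isMarkovKernel_pow (n : ℕ) : IsMarkovKernel (κ ^ n) := by
  induction n with
  | zero => exact inferInstanceAs (IsMarkovKernel Kernel.id)
  | succ n ih => exact inferInstanceAs (IsMarkovKernel ((κ ^ n) ∘ₖ κ))

/-- Composition with the first coordinate, as an isometry of `L²` spaces. -/
noncomputable def fstLp (π : Measure α) [IsProbabilityMeasure π] (κ : Kernel α α)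
    [IsMarkovKernel κ] : Lp ℝ 2 π →ₗᵢ[ℝ] Lp ℝ 2 (π ⊗ₘ κ) :=
  Lp.compMeasurePreservingₗᵢ ℝ Prod.fst measurePreserving_fst_compProd

/-- Composition with the second coordinate, as an isometry of `L²` spaces. -/
noncomputable def sndLp (h : SymmetricPair π κ) : Lp ℝ 2 π →ₗᵢ[ℝ] Lp ℝ 2 (π ⊗ₘ κ) :=
  Lp.compMeasurePreservingₗᵢ ℝ Prod.snd h.measurePreserving_snd

theorem coeFn_fstLp (u : Lp ℝ 2 π) : fstLp π κ u =ᵐ[π ⊗ₘ κ] fun p => u p.1 :=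
  Lp.coeFn_compMeasurePreserving u measurePreserving_fst_compProd

theorem coeFn_sndLp (h : SymmetricPair π κ) (u : Lp ℝ 2 π) :
    sndLp h u =ᵐ[π ⊗ₘ κ] fun p => u p.2 :=
  Lp.coeFn_compMeasurePreserving u h.measurePreserving_snd

/-- The operator on `L²(π)` of a kernel that is reversible with respect to `π`. -/
noncomputable def opLp (h : SymmetricPair π κ) : Lp ℝ 2 π →L[ℝ] Lp ℝ 2 π :=
  (ContinuousLinearMap.adjoint (fstLp π κ).toContinuousLinearMap) ∘L
    (sndLp h).toContinuousLinearMap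

/-- The adjoint of the first-coordinate embedding acts as conditional expectation given the first
state. Symmetry and the action on functions are read off this bilinear form. -/
theorem inner_opLp (h : SymmetricPair π κ) (u w : Lp ℝ 2 π) :
    inner ℝ u (opLp h w) = ∫ p, u p.1 * w p.2 ∂(π ⊗ₘ κ) := by
  have : inner ℝ u (opLp h w) = inner ℝ (fstLp π κ u) (sndLp h w) := by
    simp [opLp, ContinuousLinearMap.adjoint_inner_right]
  rw [this, L2.inner_def]
  refine integral_congr_ae ?_
  filter_upwards [coeFn_fstLp (κ := κ) u, coeFn_sndLp h w] with p h1 h2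
  rw [h1, h2]
  simp [mul_comm]

theorem opLp_symm (h : SymmetricPair π κ) (u w : Lp ℝ 2 π) :
    inner ℝ (opLp h u) w = inner ℝ u (opLp h w) := by
  rw [real_inner_comm, inner_opLp, inner_opLp,
    ← h.measurePreserving_swap.integral_comp MeasurableEquiv.prodComm.measurableEmbedding]
  simp [mul_comm]

theorem norm_adjoint_apply_le {H K : Type*} [NormedAddCommGroup H] [InnerProductSpace ℝ H]
    [CompleteSpace H] [NormedAddCommGroup K] [InnerProductSpace ℝ K] [CompleteSpace K]
    (J : H →ₗᵢ[ℝ] K) (v : K) :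
    ‖ContinuousLinearMap.adjoint J.toContinuousLinearMap v‖ ≤ ‖v‖ := by
  refine (ContinuousLinearMap.le_opNorm _ _).trans ?_
  rw [LinearIsometryEquiv.norm_map]
  exact mul_le_of_le_one_left (norm_nonneg _) J.norm_toContinuousLinearMap_le

theorem norm_opLp_le (h : SymmetricPair π κ) (u : Lp ℝ 2 π) : ‖opLp h u‖ ≤ ‖u‖ := by
  refine (norm_adjoint_apply_le (fstLp π κ) (sndLp h u)).trans_eq ?_
  exact (sndLp h).norm_map u

/-- A vector whose norm is not decreased by the adjoint of an isometry lies in its range. -/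
theorem eq_of_norm_adjoint_eq {H K : Type*} [NormedAddCommGroup H] [InnerProductSpace ℝ H]
    [CompleteSpace H] [NormedAddCommGroup K] [InnerProductSpace ℝ K] [CompleteSpace K]
    (J : H →ₗᵢ[ℝ] K) (v : K)
    (hv : ‖ContinuousLinearMap.adjoint J.toContinuousLinearMap v‖ = ‖v‖) :
    J (ContinuousLinearMap.adjoint J.toContinuousLinearMap v) = v := by
  -- With `J†` the adjoint, `‖J J† v - v‖² = ‖J† v‖² - 2 ‖J† v‖² + ‖v‖²`, which vanishes when the
  -- norms agree.
  rw [← sub_eq_zero, ← norm_eq_zero, ← sq_eq_zero_iff, norm_sub_sq_real, J.norm_map, hv]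
  have : inner ℝ (J (ContinuousLinearMap.adjoint J.toContinuousLinearMap v)) v
      = ‖ContinuousLinearMap.adjoint J.toContinuousLinearMap v‖ ^ 2 := by
    rw [← real_inner_self_eq_norm_sq, ContinuousLinearMap.adjoint_inner_right]
    rfl
  rw [this, hv]
  ring

/-- If all transition laws dominate `π`, the fixed points of the square of the operator are
constant. -/
theorem ae_const_of_opLp_opLp_eq (h : SymmetricPair π κ) (hac : ∀ x, π ≪ κ x) {g : Lp ℝ 2 π}
    (hg : opLp h (opLp h g) = g) : ∃ c : ℝ, g =ᵐ[π] fun _ => c := by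
  have hn : ‖opLp h g‖ = ‖g‖ := by
    refine le_antisymm (norm_opLp_le h g) ?_
    conv_lhs => rw [← hg]
    exact norm_opLp_le h _
  -- No norm is lost, so `g` of the second state is almost surely a function of the first. Freezing
  -- one good first state `x` makes `g` constant `κ x`-a.e., hence `π`-a.e. by domination.
  have heq : fstLp π κ (opLp h g) = sndLp h g := by
    refine eq_of_norm_adjoint_eq (fstLp π κ) (sndLp h g) ?_
    rw [(sndLp h).norm_map]
    exact hn
  have hae : ∀ᵐ p ∂(π ⊗ₘ κ), opLp h g p.1 = g p.2 := by
    filter_upwards [coeFn_fstLp (κ := κ) (opLp h g), coeFn_sndLp h g] with p h1 h2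
    rw [← h1, ← h2, heq]
  obtain ⟨x, hx⟩ := (Measure.ae_ae_of_ae_compProd hae).exists
  exact ⟨opLp h g x, (hac x).ae_le (hx.mono fun y hy => hy.symm)⟩

/-- Testing against every `u` and disintegrating identifies the abstract adjoint with integration
against the kernel. -/
theorem opLp_eq_of_integral (h : SymmetricPair π κ) {w v : α → ℝ} (hw : MemLp w 2 π)
    (hv : MemLp v 2 π) (hwv : ∀ x, ∫ y, w y ∂(κ x) = v x) :
    opLp h hw.toLp = hv.toLp := by
  refine ext_inner_left ℝ fun u => ?_
  rw [inner_opLp]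
  have h1 : (fun p : α × α => u p.1 * (hw.toLp w : Lp ℝ 2 π) p.2) =ᵐ[π ⊗ₘ κ] fun p => u p.1 * w p.2 := by
    filter_upwards [h.measurePreserving_snd.quasiMeasurePreserving.ae hw.coeFn_toLp] with p hp
    rw [hp]
  have hint : Integrable (fun p : α × α => u p.1 * w p.2) (π ⊗ₘ κ) := by
    have a1 := (Lp.memLp u).comp_measurePreserving (measurePreserving_fst_compProd (κ := κ))
    have a2 := hw.comp_measurePreserving h.measurePreserving_snd
    exact a1.integrable_mul a2
  rw [integral_congr_ae h1, Measure.integral_compProd hint, L2.inner_def]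
  refine integral_congr_ae ?_
  filter_upwards [hv.coeFn_toLp] with x hx
  rw [integral_const_mul, hwv, hx]
  simp [mul_comm]

theorem memLp_real_apply (η : Kernel α α) [IsMarkovKernel η] {A : Set α} (hA : MeasurableSet A) :
    MemLp (fun x => (η x).real A) 2 π := by
  refine MemLp.of_bound (C := 1) ?_ (Eventually.of_forall fun x => ?_)
  · exact ((η.measurable_coe hA).ennreal_toReal).aestronglyMeasurable
  · rw [Real.norm_of_nonneg measureReal_nonneg]
    exact measureReal_le_one

theorem integral_pow_real_apply (n : ℕ) {A : Set α} (hA : MeasurableSet A) (x : α) :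
    ∫ y, ((κ ^ n) y).real A ∂(κ x) = ((κ ^ (n + 1)) x).real A := by
  have : (κ ^ (n + 1)) x A = ∫⁻ y, (κ ^ n) y A ∂(κ x) := by
    rw [pow_succ]
    exact Kernel.comp_apply' _ _ _ hA
  simp only [Measure.real]
  rw [this, integral_toReal ((κ ^ n).measurable_coe hA).aemeasurable]
  exact Eventually.of_forall fun y => measure_lt_top _ _

theorem opLp_pow_indicator (h : SymmetricPair π κ) {A : Set α} (hA : MeasurableSet A) (n : ℕ) :
    (opLp h ^ n) (indicatorConstLp 2 hA (measure_ne_top π A) (1 : ℝ)) =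
      (memLp_real_apply (π := π) (κ ^ n) hA).toLp := by
  induction n with
  | zero =>
    rw [pow_zero, one_apply_eq_self]
    refine Lp.ext ?_
    refine indicatorConstLp_coeFn.trans (Filter.EventuallyEq.trans ?_ (MemLp.coeFn_toLp _).symm)
    refine Eventually.of_forall fun x => ?_
    change _ = (Kernel.id x).real A
    rw [Kernel.id_apply, Measure.real, Measure.dirac_apply' _ hA]
    by_cases hx : x ∈ A <;> simp [hx]
  | succ n ih =>
    rw [pow_succ', mul_apply_eq_comp, ih]
    exact opLp_eq_of_integral h _ _ fun x => integral_pow_real_apply n hA x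

theorem opLp_const (h : SymmetricPair π κ) (c : ℝ) :
    opLp h (Lp.const 2 π c) = Lp.const 2 π c := by
  refine opLp_eq_of_integral h (memLp_const c) (memLp_const c) fun x => ?_
  simp

theorem opLp_pow_symm (h : SymmetricPair π κ) (n : ℕ) (u w : Lp ℝ 2 π) :
    inner ℝ ((opLp h ^ n) u) w = inner ℝ u ((opLp h ^ n) w) := by
  induction n generalizing u w with
  | zero => simp
  | succ n ih =>
    rw [pow_succ, mul_apply_eq_comp, ih, opLp_symm, ← mul_apply_eq_comp,
      ← pow_succ', pow_succ]

theorem inner_const_right (u : Lp ℝ 2 π) (c : ℝ) :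
    inner ℝ u (Lp.const 2 π c) = c * ∫ x, u x ∂π := by
  rw [L2.inner_def, ← integral_const_mul]
  refine integral_congr_ae ?_
  filter_upwards [Lp.coeFn_const (p := 2) (μ := π) c] with x hx
  rw [hx]
  simp

/-- The limit of the even powers is constant, and constants are fixed by the operator, so the odd
powers share it. Its value is found by pairing with the invariant function `1`. -/
theorem tendsto_opLp_pow (h : SymmetricPair π κ) (hac : ∀ x, π ≪ κ x) (u : Lp ℝ 2 π) :
    Tendsto (fun n : ℕ => (opLp h ^ n) u) atTop (𝓝 (Lp.const 2 π (∫ x, u x ∂π))) := by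
  obtain ⟨g, hg, hgg⟩ :=
    exists_tendsto_even_pow_of_symmetric (opLp h) (opLp_symm h) (norm_opLp_le h) u
  obtain ⟨c, hc⟩ := ae_const_of_opLp_opLp_eq h hac hgg
  have hgc : g = Lp.const 2 π c := Lp.ext (hc.trans (Lp.coeFn_const (p := 2) (μ := π) c).symm)
  have hodd : Tendsto (fun n : ℕ => (opLp h ^ (2 * n + 1)) u) atTop (𝓝 g) := by
    have h1 := ((opLp h).continuous.tendsto g).comp hg
    rw [hgc, opLp_const, ← hgc] at h1
    refine h1.congr fun n => ?_
    rw [pow_succ', mul_apply_eq_comp]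
    rfl
  have hall : Tendsto (fun n : ℕ => (opLp h ^ n) u) atTop (𝓝 g) := by
    rw [Metric.tendsto_atTop] at hg hodd ⊢
    intro ε hε
    obtain ⟨N, hN⟩ := hg ε hε
    obtain ⟨M, hM⟩ := hodd ε hε
    refine ⟨2 * N + 2 * M + 1, fun n hn => ?_⟩
    obtain ⟨k, rfl | rfl⟩ := n.even_or_odd'
    · exact hN k (by omega)
    · exact hM k (by omega)
  have hcu : c = ∫ x, u x ∂π := by
    have h1 : Tendsto (fun n : ℕ => inner ℝ ((opLp h ^ n) u) (Lp.const 2 π (1 : ℝ))) atTop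
        (𝓝 (inner ℝ g (Lp.const 2 π (1 : ℝ)))) := hall.inner tendsto_const_nhds
    have h2 : ∀ n : ℕ, (opLp h ^ n) (Lp.const 2 π (1 : ℝ)) = Lp.const 2 π (1 : ℝ) := by
      intro n
      induction n with
      | zero => simp
      | succ n ih => rw [pow_succ', mul_apply_eq_comp, ih, opLp_const]
    have h3 := tendsto_nhds_unique (h1.congr fun n => by rw [opLp_pow_symm, h2])
      tendsto_const_nhds
    rw [inner_const_right, inner_const_right, integral_congr_ae hc] at h3
    simpa using h3
  rw [← hcu, ← hgc]
  exact hall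

end Reversible

/-! ### From `L²` convergence to total variation -/

section Convergence

variable {α : Type*} [MeasurableSpace α] {π : Measure α} [IsProbabilityMeasure π]
  {κ : Kernel α α} [IsMarkovKernel κ]

omit [IsProbabilityMeasure π] in
theorem integrable_mul_real_apply (η : Kernel α α) [IsMarkovKernel η] {f : α → ℝ}
    (hf : Integrable f π) {A : Set α} (hA : MeasurableSet A) :
    Integrable (fun x => f x * (η x).real A) π := by
  refine hf.mul_bdd (c := 1) ?_ (Eventually.of_forall fun x => ?_)
  · exact ((η.measurable_coe hA).ennreal_toReal).aestronglyMeasurable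
  · rw [Real.norm_of_nonneg measureReal_nonneg]
    exact measureReal_le_one

/-- Symmetry moves the power of the operator onto `f`; Cauchy–Schwarz with indicators of norm at
most `1` then gives a bound independent of `A`, as total variation requires. -/
theorem eventually_abs_integral_pow_sub_le_of_memLp (h : SymmetricPair π κ)
    (hac : ∀ x, π ≪ κ x) {f : α → ℝ} (hf : MemLp f 2 π) {ε : ℝ} (hε : 0 < ε) :
    ∀ᶠ n : ℕ in atTop, ∀ A, MeasurableSet A →
      |∫ x, f x * ((κ ^ n) x).real A ∂π - (∫ x, f x ∂π) * π.real A| ≤ ε := by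
  have hlim := tendsto_opLp_pow h hac (hf.toLp f)
  rw [integral_congr_ae hf.coeFn_toLp] at hlim
  filter_upwards [(Metric.tendsto_nhds.1 hlim) ε hε] with n hn A hA
  set u := hf.toLp f
  set v := indicatorConstLp 2 hA (measure_ne_top π A) (1 : ℝ)
  have h1 : ∫ x, f x * ((κ ^ n) x).real A ∂π = inner ℝ ((opLp h ^ n) u) v := by
    rw [opLp_pow_symm, opLp_pow_indicator, L2.inner_def]
    refine integral_congr_ae ?_
    filter_upwards [hf.coeFn_toLp, (memLp_real_apply (π := π) (κ ^ n) hA).coeFn_toLp] with x h1 h2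
    rw [h1, h2]
    simp [mul_comm]
  have h2 : (∫ x, f x ∂π) * π.real A = inner ℝ (Lp.const 2 π (∫ x, f x ∂π)) v := by
    rw [real_inner_comm, inner_const_right, integral_indicatorConstLp]
    simp
  have hv : ‖v‖ ≤ 1 := by
    rw [norm_indicatorConstLp (by norm_num) (by norm_num), norm_one, one_mul]
    exact Real.rpow_le_one measureReal_nonneg measureReal_le_one (by positivity)
  rw [h1, h2, ← inner_sub_left]
  refine (abs_real_inner_le_norm _ _).trans ?_
  rw [dist_eq_norm] at hn
  exact (mul_le_of_le_one_right (norm_nonneg _) hv).trans hn.le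

/-- Approximation of `f` in `L¹` by a simple function: transition probabilities are at most `1`, so
the `L¹` error bounds both substitutions. This matters because the density of an initial law need
not be square integrable. -/
theorem eventually_abs_integral_pow_sub_le (h : SymmetricPair π κ)
    (hac : ∀ x, π ≪ κ x) {f : α → ℝ} (hf : Integrable f π) {ε : ℝ} (hε : 0 < ε) :
    ∀ᶠ n : ℕ in atTop, ∀ A, MeasurableSet A →
      |∫ x, f x * ((κ ^ n) x).real A ∂π - (∫ x, f x ∂π) * π.real A| ≤ ε := by
  obtain ⟨g, hg, -⟩ := (memLp_one_iff_integrable.2 hf).exists_simpleFunc_eLpNorm_sub_lt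
    ENNReal.one_ne_top (ε := ENNReal.ofReal (ε / 3)) (by simpa using hε)
  have hg2 : MemLp g 2 π := g.memLp_of_isFiniteMeasure 2 π
  have hgi : Integrable g π := hg2.integrable (by norm_num)
  have hdiff : ∫ x, |f x - g x| ∂π ≤ ε / 3 := by
    rw [eLpNorm_one_eq_lintegral_enorm] at hg
    have := integral_norm_eq_lintegral_enorm (hf.sub hgi).aestronglyMeasurable
    simp only [Pi.sub_apply, Real.norm_eq_abs] at this
    rw [this]
    exact ENNReal.toReal_le_of_le_ofReal (by positivity) hg.le
  filter_upwards [eventually_abs_integral_pow_sub_le_of_memLp h hac hg2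
    (ε := ε / 3) (by positivity)] with n hn A hA
  have hn := hn A hA
  have e1 : |∫ x, f x * ((κ ^ n) x).real A ∂π - ∫ x, g x * ((κ ^ n) x).real A ∂π| ≤ ε / 3 := by
    rw [← integral_sub (integrable_mul_real_apply _ hf hA) (integrable_mul_real_apply _ hgi hA)]
    refine abs_integral_le_integral_abs.trans (le_trans ?_ hdiff)
    refine integral_mono_of_nonneg (Eventually.of_forall fun x => abs_nonneg _)
      (hf.sub hgi).abs (Eventually.of_forall fun x => ?_)
    simp only [← sub_mul, abs_mul, abs_of_nonneg (measureReal_nonneg (μ := (κ ^ n) x) (s := A))]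
    exact mul_le_of_le_one_right (abs_nonneg _) measureReal_le_one
  have e2 : |(∫ x, g x ∂π) * π.real A - (∫ x, f x ∂π) * π.real A| ≤ ε / 3 := by
    rw [← sub_mul, abs_mul, abs_of_nonneg (measureReal_nonneg (μ := π) (s := A)), abs_sub_comm,
      ← integral_sub hf hgi]
    exact (mul_le_of_le_one_right (abs_nonneg _) measureReal_le_one).trans
      (abs_integral_le_integral_abs.trans hdiff)
  rw [abs_le] at *
  constructor <;> linarith [e1.1, e1.2, e2.1, e2.2, hn.1, hn.2]

theorem eventually_abs_bind_pow_sub_le (h : SymmetricPair π κ) (hac : ∀ x, π ≪ κ x)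
    {ν : Measure α} [IsFiniteMeasure ν] (hν : ν ≪ π) {ε : ℝ} (hε : 0 < ε) :
    ∀ᶠ n : ℕ in atTop, ∀ A, MeasurableSet A →
      |∫ x, ((κ ^ n) x).real A ∂ν - ν.real Set.univ * π.real A| ≤ ε := by
  filter_upwards [eventually_abs_integral_pow_sub_le h hac
    (Measure.integrable_toReal_rnDeriv (μ := ν) (ν := π)) hε] with n hn A hA
  have := hn A hA
  rw [Measure.integral_toReal_rnDeriv hν] at this
  have h2 := integral_rnDeriv_smul hν (f := fun x => ((κ ^ n) x).real A)
  simp only [smul_eq_mul] at h2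
  rwa [h2] at this

/-- A sequence with `u (n + 1) ≤ r * u n + e n`, where `r < 1` and `e` is eventually small, tends
to zero. -/
theorem tendsto_zero_of_le_mul_add {u : ℕ → ℝ} {r : ℝ} (hu : ∀ n, 0 ≤ u n)
    (hub : ∀ n, u n ≤ 1) (hr0 : 0 ≤ r) (hr : r < 1)
    (hrec : ∀ ε > 0, ∀ᶠ n in atTop, u (n + 1) ≤ r * u n + ε) : Tendsto u atTop (𝓝 0) := by
  rw [Metric.tendsto_atTop]
  intro ε hε
  -- This error makes `ε / 2` the fixed point of the affine recursion.
  obtain ⟨N, hN⟩ := eventually_atTop.1 (hrec (ε / 2 * (1 - r)) (by nlinarith))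
  have hk : ∀ k, u (N + k) ≤ r ^ k + ε / 2 := by
    intro k
    induction k with
    | zero => simpa using (hub N).trans (by linarith)
    | succ k ih =>
      have h1 := hN (N + k) (by omega)
      have h2 := mul_le_mul_of_nonneg_left ih hr0
      rw [← add_assoc, pow_succ']
      linarith
  obtain ⟨K, hK⟩ := exists_pow_lt_of_lt_one (half_pos hε) hr
  refine ⟨N + K, fun n hn => ?_⟩
  obtain ⟨k, rfl⟩ := Nat.exists_eq_add_of_le hn
  rw [Real.dist_0_eq_abs, abs_of_nonneg (hu _), add_assoc]
  have h3 : r ^ (K + k) ≤ r ^ K := pow_le_pow_of_le_one hr0 hr.le (by omega)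
  linarith [hk (K + k)]

theorem bddAbove_range_tv (μ ν : Measure α) [IsProbabilityMeasure μ] [IsProbabilityMeasure ν] :
    BddAbove (Set.range fun A : {A : Set α // MeasurableSet A} => |μ.real A.1 - ν.real A.1|) := by
  refine ⟨1, ?_⟩
  rintro _ ⟨A, rfl⟩
  have h1 := measureReal_nonneg (μ := μ) (s := A.1)
  have h2 := measureReal_nonneg (μ := ν) (s := A.1)
  have h3 := measureReal_le_one (μ := μ) (s := A.1)
  have h4 := measureReal_le_one (μ := ν) (s := A.1)
  exact abs_le.2 ⟨by linarith, by linarith⟩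

theorem abs_sub_le_tvDist (μ ν : Measure α) [IsProbabilityMeasure μ] [IsProbabilityMeasure ν]
    {A : Set α} (hA : MeasurableSet A) : |μ.real A - ν.real A| ≤ tvDist μ ν :=
  le_ciSup (bddAbove_range_tv μ ν) ⟨A, hA⟩

theorem tvDist_le {μ ν : Measure α} {c : ℝ}
    (hc : ∀ A, MeasurableSet A → |μ.real A - ν.real A| ≤ c) : tvDist μ ν ≤ c :=
  have : Nonempty {A : Set α // MeasurableSet A} := ⟨⟨∅, MeasurableSet.empty⟩⟩
  ciSup_le fun A => hc A.1 A.2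

/-- A reversible kernel whose transition laws all dominate the stationary law converges in total
variation from every point at which its transition law is a sum of a mass `r < 1` staying at the
point and an absolutely continuous part. -/
theorem tendsto_tvDist_pow (h : SymmetricPair π κ) (hac : ∀ x, π ≪ κ x) {x : α} {r : ENNReal}
    (hr : r < 1) {ν : Measure α} (hν : ν ≪ π) (hx : κ x = r • Measure.dirac x + ν) :
    Tendsto (fun n : ℕ => tvDist ((κ ^ n) x) π) atTop (𝓝 0) := by
  have hνle : ν ≤ κ x := hx ▸ Measure.le_add_left le_rfl
  have : IsFiniteMeasure ν := isFiniteMeasure_of_le _ hνle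
  have hsum : r.toReal + ν.real Set.univ = 1 := by
    have h1 : κ x Set.univ = r + ν Set.univ := by rw [hx]; simp
    rw [measure_univ] at h1
    rw [Measure.real, ← ENNReal.toReal_add hr.ne_top (measure_ne_top _ _), ← h1,
      ENNReal.toReal_one]
  have hr' : r.toReal < 1 := by
    simpa using (ENNReal.toReal_lt_toReal hr.ne_top ENNReal.one_ne_top).2 hr
  have hint : ∀ n A, MeasurableSet A → ∀ m : Measure α, IsFiniteMeasure m →
      Integrable (fun y => ((κ ^ n) y).real A) m := by
    intro n A hA m _
    refine Integrable.of_bound (((κ ^ n).measurable_coe hA).ennreal_toReal).aestronglyMeasurable 1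
      (Eventually.of_forall fun x => ?_)
    rw [Real.norm_of_nonneg measureReal_nonneg]
    exact measureReal_le_one
  -- Conditioning on the first step: the chain either stays at `x` or restarts from `ν`.
  have hstep : ∀ n A, MeasurableSet A → ((κ ^ (n + 1)) x).real A =
      r.toReal * ((κ ^ n) x).real A + ∫ y, ((κ ^ n) y).real A ∂ν := by
    intro n A hA
    have hsm : StronglyMeasurable fun y => ((κ ^ n) y).real A :=
      ((κ ^ n).measurable_coe hA).ennreal_toReal.stronglyMeasurable
    have : IsFiniteMeasure (r • Measure.dirac x) :=
      isFiniteMeasure_of_le (κ x) (hx ▸ Measure.le_add_right le_rfl)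
    rw [← integral_pow_real_apply n hA, hx,
      integral_add_measure (hint n A hA _ inferInstance) (hint n A hA _ inferInstance),
      integral_smul_measure, integral_dirac' _ _ hsm, smul_eq_mul]
  refine tendsto_zero_of_le_mul_add (r := r.toReal)
    (fun n => (abs_nonneg _).trans (abs_sub_le_tvDist _ _ MeasurableSet.empty))
    (fun n => tvDist_le fun A hA => ?_) ENNReal.toReal_nonneg hr' fun ε hε => ?_
  · have h1 := measureReal_nonneg (μ := (κ ^ n) x) (s := A)
    have h2 := measureReal_nonneg (μ := π) (s := A)
    have h3 := measureReal_le_one (μ := (κ ^ n) x) (s := A)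
    have h4 := measureReal_le_one (μ := π) (s := A)
    exact abs_le.2 ⟨by linarith, by linarith⟩
  · filter_upwards [eventually_abs_bind_pow_sub_le h hac hν hε] with n hn
    refine tvDist_le fun A hA => ?_
    have h1 : ((κ ^ (n + 1)) x).real A - π.real A =
        r.toReal * (((κ ^ n) x).real A - π.real A) +
          (∫ y, ((κ ^ n) y).real A ∂ν - ν.real Set.univ * π.real A) := by
      rw [hstep n A hA]
      linear_combination (π.real A) * hsum
    rw [h1]
    refine (abs_add_le _ _).trans (add_le_add ?_ (hn A hA))
    rw [abs_mul, abs_of_nonneg ENNReal.toReal_nonneg]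
    exact mul_le_mul_of_nonneg_left (abs_sub_le_tvDist _ _ hA) ENNReal.toReal_nonneg

end Convergence

/-! ### Density and symmetries of the standard Gaussian measure -/

section Gaussian

variable {V : Type*} [NormedAddCommGroup V] [InnerProductSpace ℝ V] [FiniteDimensional ℝ V]
  [MeasurableSpace V] [BorelSpace V]

/-- Both sides are finite measures with the same characteristic function. The explicit density is
needed for the energy computation and for comparing null sets with Lebesgue measure. -/
theorem stdGaussian_eq_withDensity : stdGaussian V = volume.withDensity fun v =>
    ENNReal.ofReal (((2 * Real.pi) ^ (Module.finrank ℝ V / 2 : ℝ))⁻¹ * Real.exp (-(‖v‖ ^ 2 / 2))) := by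
  set C : ℝ := ((2 * Real.pi) ^ (Module.finrank ℝ V / 2 : ℝ))⁻¹ with hC
  have hfourier : ∀ t : V, ∫ v : V, Complex.exp (-(1 / 2 : ℂ) * ‖v‖ ^ 2 + Complex.I * inner ℝ t v) =
      (C : ℂ)⁻¹ * Complex.exp (-‖t‖ ^ 2 / 2) := by
    intro t
    rw [GaussianFourier.integral_cexp_neg_mul_sq_norm_add (by norm_num)]
    congr 1
    · rw [hC, Complex.ofReal_inv, inv_inv, Complex.ofReal_cpow (by positivity)]
      push_cast
      congr 1
      ring
    · congr 1
      rw [Complex.I_sq]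
      ring
  have hint : Integrable fun v : V => C * Real.exp (-(‖v‖ ^ 2 / 2)) := by
    refine Integrable.const_mul ?_ C
    have h1 := (GaussianFourier.integrable_cexp_neg_mul_sq_norm_add (V := V)
      (b := 1 / 2) (by norm_num) 0 0).norm
    refine h1.congr (Eventually.of_forall fun v => ?_)
    simp only [Complex.norm_exp]
    congr 1
    simp [← Complex.ofReal_pow]
    ring
  have : IsFiniteMeasure (volume.withDensity fun v : V =>
      ENNReal.ofReal (C * Real.exp (-(‖v‖ ^ 2 / 2)))) :=
    isFiniteMeasure_withDensity_ofReal hint.2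
  refine Measure.ext_of_charFun (funext fun t => ?_)
  have hCpos : 0 < C := by positivity
  rw [charFun_stdGaussian, charFun_apply, integral_withDensity_eq_integral_toReal_smul (by fun_prop)
    (by simp)]
  have h2 : ∀ v : V, (ENNReal.ofReal (C * Real.exp (-(‖v‖ ^ 2 / 2)))).toReal •
      Complex.exp ((inner ℝ v t : ℝ) * Complex.I) =
      (C : ℂ) * Complex.exp (-(1 / 2 : ℂ) * ‖v‖ ^ 2 + Complex.I * (inner ℝ t v : ℝ)) := by
    intro v
    rw [ENNReal.toReal_ofReal (by positivity), Complex.exp_add, real_inner_comm, Complex.real_smul]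
    push_cast
    ring_nf
  simp_rw [h2]
  rw [integral_const_mul, hfourier, ← mul_assoc, mul_inv_cancel₀ (by exact_mod_cast hCpos.ne'),
    one_mul]

theorem stdGaussian_absolutelyContinuous : stdGaussian V ≪ volume := by
  rw [stdGaussian_eq_withDensity]
  exact withDensity_absolutelyContinuous _ _

theorem volume_absolutelyContinuous_stdGaussian : (volume : Measure V) ≪ stdGaussian V := by
  rw [stdGaussian_eq_withDensity]
  refine withDensity_absolutelyContinuous' (by fun_prop) (Eventually.of_forall fun v => ?_)
  simp only [ne_eq, ENNReal.ofReal_eq_zero, not_le]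
  positivity

theorem measurePreserving_neg_stdGaussian :
    MeasurePreserving (fun v : V => -v) (stdGaussian V) (stdGaussian V) :=
  ⟨measurable_neg, stdGaussian_map (LinearIsometryEquiv.neg ℝ)⟩

/-- A reflection in the plane spanned by two independent standard Gaussian vectors preserves their
joint law. -/
theorem measurePreserving_reflection_stdGaussian {a b : ℝ} (hab : a ^ 2 + b ^ 2 = 1) :
    MeasurePreserving (fun p : V × V => (a • p.1 + b • p.2, b • p.1 - a • p.2))
      ((stdGaussian V).prod (stdGaussian V)) ((stdGaussian V).prod (stdGaussian V)) := by
  have hm : Measurable fun p : V × V => (a • p.1 + b • p.2, b • p.1 - a • p.2) := by fun_prop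
  refine ⟨hm, ?_⟩
  have : IsFiniteMeasure (((stdGaussian V).prod (stdGaussian V)).map
    fun p : V × V => (a • p.1 + b • p.2, b • p.1 - a • p.2)) := Measure.isFiniteMeasure_map _ _
  refine charFun_eq_prod_iff.1 fun t => ?_
  rw [charFun_apply, integral_map (by fun_prop) (by fun_prop), integral_map (by fun_prop)
    (by fun_prop)]
  have h1 : ∀ p : V × V,
      Complex.exp ((inner ℝ (WithLp.toLp 2 (a • p.1 + b • p.2, b • p.1 - a • p.2)) t : ℝ)
        * Complex.I) =
      Complex.exp ((inner ℝ p.1 (a • t.fst + b • t.snd) : ℝ) * Complex.I) *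
      Complex.exp ((inner ℝ p.2 (b • t.fst - a • t.snd) : ℝ) * Complex.I) := by
    intro p
    rw [← Complex.exp_add, ← add_mul, ← Complex.ofReal_add]
    congr 3
    simp only [WithLp.prod_inner_apply, inner_add_left, inner_add_right, inner_sub_left,
      inner_sub_right, real_inner_smul_left, real_inner_smul_right]
    simp only [WithLp.ofLp_fst, WithLp.ofLp_snd]
    ring
  simp_rw [h1]
  rw [integral_prod_mul (fun x : V => Complex.exp ((inner ℝ x (a • t.fst + b • t.snd) : ℝ)
    * Complex.I)) (fun x : V => Complex.exp ((inner ℝ x (b • t.fst - a • t.snd) : ℝ)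
    * Complex.I)), ← charFun_apply, ← charFun_apply]
  simp only [charFun_stdGaussian, ← Complex.exp_add]
  congr 1
  -- The transposed map is orthogonal, and the joint characteristic function depends only on this
  -- sum of squares.
  have h2 : ‖a • t.fst + b • t.snd‖ ^ 2 + ‖b • t.fst - a • t.snd‖ ^ 2 =
      ‖t.fst‖ ^ 2 + ‖t.snd‖ ^ 2 := by
    rw [norm_add_sq_real, norm_sub_sq_real]
    simp only [norm_smul, mul_pow, real_inner_smul_left, real_inner_smul_right, Real.norm_eq_abs,
      sq_abs]
    linear_combination (‖t.fst‖ ^ 2 + ‖t.snd‖ ^ 2) * hab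
  have h3 : ((‖a • t.fst + b • t.snd‖ ^ 2 + ‖b • t.fst - a • t.snd‖ ^ 2 : ℝ) : ℂ) =
      ((‖t.fst‖ ^ 2 + ‖t.snd‖ ^ 2 : ℝ) : ℂ) := by rw [h2]
  push_cast at h3
  simp only [WithLp.ofLp_fst, WithLp.ofLp_snd]
  linear_combination (-1 / 2 : ℂ) * h3

end Gaussian


/-! ### Time reversal of one OBABO step -/

section Dynamics

variable {d : ℕ} {Φ : E d → ℝ} {h γ : ℝ}

theorem continuous_gradient (hΦ : ContDiff ℝ 1 Φ) : Continuous (gradient Φ) :=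
  (LinearIsometryEquiv.continuous _).comp (hΦ.continuous_fderiv (by norm_num))

/-- The velocity flip. -/
def flip (z : E d × E d) : E d × E d := (z.1, -z.2)

@[simp] theorem flip_flip (z : E d × E d) : flip (flip z) = z := by simp [flip]

@[simp] theorem flip_fst (z : E d × E d) : (flip z).1 = z.1 := rfl

@[fun_prop]
theorem measurable_flip : Measurable (flip : E d × E d → E d × E d) := by
  unfold flip; fun_prop

/-- The velocity update of the leapfrog integrator. -/
noncomputable def kick (Φ : E d → ℝ) (h : ℝ) (z : E d × E d) : E d × E d :=
  (z.1, -((h / 2) • gradient Φ z.1) + z.2)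

/-- The position update of the leapfrog integrator. -/
noncomputable def drift (h : ℝ) (z : E d × E d) : E d × E d := (h • z.2 + z.1, z.2)

/-- One step of the leapfrog integrator. -/
noncomputable def leapfrog (Φ : E d → ℝ) (h : ℝ) (z : E d × E d) : E d × E d :=
  kick Φ h (drift h (kick Φ h z))

/-- The partial refreshment of the velocity. -/
noncomputable def refresh (h γ : ℝ) (v ξ : E d) : E d :=
  Real.exp (-(γ * h / 2)) • v + √(1 - Real.exp (-(γ * h / 2)) ^ 2) • ξ

theorem obabo_eq (z ξ : E d × E d) : obabo Φ h γ z ξ =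
    ((leapfrog Φ h (z.1, refresh h γ z.2 ξ.1)).1,
      refresh h γ (leapfrog Φ h (z.1, refresh h γ z.2 ξ.1)).2 ξ.2) := by
  have h1 : ∀ v, z.1 + h • (v - (h / 2) • gradient Φ z.1) =
      h • (-((h / 2) • gradient Φ z.1) + v) + z.1 := fun v => by module
  simp only [obabo, leapfrog, kick, drift, refresh, h1, neg_add_eq_sub]

/-- The kick–drift–kick scheme is palindromic, and each factor is undone by itself after a velocity
flip. -/
theorem flip_leapfrog_flip_leapfrog (z : E d × E d) :
    leapfrog Φ h (flip (leapfrog Φ h z)) = flip z := by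
  obtain ⟨x, v⟩ := z
  simp only [leapfrog, kick, drift, flip]
  set a := h • (-((h / 2) • gradient Φ x) + v) + x with ha
  have h1 : h • (-((h / 2) • gradient Φ a) + -(-((h / 2) • gradient Φ a) +
      (-((h / 2) • gradient Φ x) + v))) + a = x := by rw [ha]; module
  rw [h1]
  ext1
  · rfl
  · simp only; module

/-- A shear translates velocities by an amount depending only on the position, so invariance follows
from Fubini. No Jacobian is computed, so a continuous gradient suffices. -/
theorem measurePreserving_kick (hΦ : ContDiff ℝ 1 Φ) :
    MeasurePreserving (kick Φ h) ((volume : Measure (E d)).prod volume)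
      ((volume : Measure (E d)).prod volume) := by
  have hm := (continuous_gradient hΦ).measurable
  refine (MeasurePreserving.id volume).skew_product
    (g := fun x v => -((h / 2) • gradient Φ x) + v) (by fun_prop) ?_
  exact Eventually.of_forall fun x => map_add_left_eq_self volume _

theorem measurePreserving_drift :
    MeasurePreserving (drift h) ((volume : Measure (E d)).prod volume)
      ((volume : Measure (E d)).prod volume) := by
  have h1 : MeasurePreserving (fun z : E d × E d => (z.1, h • z.1 + z.2))
      ((volume : Measure (E d)).prod volume) ((volume : Measure (E d)).prod volume) := by
    refine (MeasurePreserving.id volume).skew_product (g := fun v x => h • v + x) (by fun_prop) ?_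
    exact Eventually.of_forall fun x => map_add_left_eq_self volume _
  exact Measure.measurePreserving_swap.comp (h1.comp Measure.measurePreserving_swap)

theorem measurePreserving_leapfrog (hΦ : ContDiff ℝ 1 Φ) :
    MeasurePreserving (leapfrog Φ h) ((volume : Measure (E d)).prod volume)
      ((volume : Measure (E d)).prod volume) :=
  (measurePreserving_kick hΦ).comp (measurePreserving_drift.comp (measurePreserving_kick hΦ))

theorem measurable_leapfrog (hΦ : ContDiff ℝ 1 Φ) : Measurable (leapfrog Φ h) :=
  (measurePreserving_leapfrog hΦ).measurable

theorem measurePreserving_flip_volume :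
    MeasurePreserving flip ((volume : Measure (E d)).prod volume)
      ((volume : Measure (E d)).prod volume) :=
  (MeasurePreserving.id volume).prod (Measure.measurePreserving_neg volume)

/-- Substituting the drift for the displacement eliminates the velocity, so the energy change
depends on the two positions alone. -/
theorem energy_leapfrog (z : E d × E d) :
    Φ (leapfrog Φ h z).1 + ‖(leapfrog Φ h z).2‖ ^ 2 / 2 =
      Φ z.1 + ‖z.2‖ ^ 2 / 2 + localError Φ h z.1 (leapfrog Φ h z).1 := by
  obtain ⟨x, v⟩ := z
  simp only [leapfrog, kick, drift, localError]
  set a := h • (-((h / 2) • gradient Φ x) + v) + x with ha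
  have h1 : a - x = h • (-((h / 2) • gradient Φ x) + v) := by rw [ha]; module
  rw [h1]
  simp only [← real_inner_self_eq_norm_sq, inner_add_left, inner_add_right, inner_neg_left,
    inner_neg_right, real_inner_smul_left, real_inner_smul_right]
  rw [real_inner_comm (gradient Φ x) (gradient Φ a), real_inner_comm v (gradient Φ x),
    real_inner_comm v (gradient Φ a)]
  ring

theorem localError_symm (x y : E d) : localError Φ h y x = -localError Φ h x y := by
  simp only [localError, ← neg_sub y x, inner_neg_left, add_comm (gradient Φ x)]
  ring

theorem measurable_localError (hΦ : ContDiff ℝ 1 Φ) :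
    Measurable fun p : E d × E d => localError Φ h p.1 p.2 := by
  have hm := (continuous_gradient hΦ).measurable
  have hc := hΦ.continuous.measurable
  unfold localError
  fun_prop

theorem measurable_refresh : Measurable fun p : E d × E d => refresh h γ p.1 p.2 := by
  unfold refresh; fun_prop

theorem measurable_refresh_comp {α : Type*} [MeasurableSpace α] {v ξ : α → E d}
    (hv : Measurable v) (hξ : Measurable ξ) : Measurable fun a => refresh h γ (v a) (ξ a) := by
  unfold refresh; fun_prop

theorem measurable_obabo (hΦ : ContDiff ℝ 1 Φ) :
    Measurable fun p : (E d × E d) × (E d × E d) => obabo Φ h γ p.1 p.2 := by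
  have hm := (continuous_gradient hΦ).measurable
  unfold obabo
  fun_prop

theorem isMarkovKernel_obaboKernel (hΦ : ContDiff ℝ 1 Φ) :
    IsMarkovKernel (obaboKernel Φ h γ) := by
  unfold obaboKernel
  exact Kernel.IsMarkovKernel.map _ (measurable_obabo hΦ)

theorem lintegral_obaboKernel (hΦ : ContDiff ℝ 1 Φ) (z : E d × E d) {F : E d × E d → ENNReal}
    (hF : Measurable F) : ∫⁻ z', F z' ∂(obaboKernel Φ h γ z) =
      ∫⁻ ξ, F (obabo Φ h γ z ξ) ∂((stdGaussian (E d)).prod (stdGaussian (E d))) := by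
  have hm := measurable_obabo (h := h) (γ := γ) hΦ
  have hFm : Measurable fun p : (E d × E d) × (E d × E d) => F (obabo Φ h γ p.1 p.2) :=
    hF.comp hm
  rw [obaboKernel, Kernel.map_apply _ hm, lintegral_map hF hm, Kernel.prod_apply,
    Kernel.id_apply, Kernel.const_apply, lintegral_prod _ hFm.aemeasurable,
    lintegral_dirac' _ hFm.lintegral_prod_right']

/-- The unnormalized joint law of position and velocity. -/
noncomputable def phaseMeasure (Φ : E d → ℝ) : Measure (E d × E d) :=
  ((volume : Measure (E d)).withDensity fun x => ENNReal.ofReal (Real.exp (-Φ x))).prod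
    (stdGaussian (E d))

theorem measurePreserving_flip (Φ : E d → ℝ) :
    MeasurePreserving flip (phaseMeasure Φ) (phaseMeasure Φ) :=
  (MeasurePreserving.id _).prod measurePreserving_neg_stdGaussian

theorem phaseMeasure_eq (hΦ : ContDiff ℝ 1 Φ) : ∃ C : ℝ, phaseMeasure Φ =
    ((volume : Measure (E d)).prod volume).withDensity fun z =>
      ENNReal.ofReal (C * Real.exp (-(Φ z.1 + ‖z.2‖ ^ 2 / 2))) := by
  have hc := hΦ.continuous.measurable
  refine ⟨((2 * Real.pi) ^ (Module.finrank ℝ (E d) / 2 : ℝ))⁻¹, ?_⟩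
  rw [phaseMeasure, stdGaussian_eq_withDensity, prod_withDensity (by fun_prop) (by fun_prop)]
  congr 1
  ext z
  rw [← ENNReal.ofReal_mul (by positivity), neg_add, Real.exp_add]
  congr 1
  ring

/-- Change of variables by the volume-preserving map "leapfrog, then flip"; the exponential factor
is the ratio of the phase densities. -/
theorem lintegral_phaseMeasure_leapfrog (hΦ : ContDiff ℝ 1 Φ) {k : E d × E d → ENNReal}
    (hk : Measurable k) : ∫⁻ z, k z ∂(phaseMeasure Φ) =
      ∫⁻ z, ENNReal.ofReal (Real.exp (-localError Φ h z.1 (leapfrog Φ h z).1)) *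
        k (flip (leapfrog Φ h z)) ∂(phaseMeasure Φ) := by
  obtain ⟨C, hC⟩ := phaseMeasure_eq hΦ
  have hc := hΦ.continuous.measurable
  have hl := measurable_leapfrog (h := h) hΦ
  have hE : Measurable fun z => localError Φ h z.1 (leapfrog Φ h z).1 :=
    (measurable_localError hΦ).comp (measurable_fst.prodMk hl.fst)
  have hkl : Measurable fun z => k (flip (leapfrog Φ h z)) := hk.comp (measurable_flip.comp hl)
  have hmp : MeasurePreserving (fun z : E d × E d => flip (leapfrog Φ h z))
      ((volume : Measure (E d)).prod volume) ((volume : Measure (E d)).prod volume) :=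
    measurePreserving_flip_volume.comp (measurePreserving_leapfrog hΦ)
  rw [hC, lintegral_withDensity_eq_lintegral_mul _ (by fun_prop) hk,
    lintegral_withDensity_eq_lintegral_mul _ (by fun_prop) (by fun_prop),
    ← hmp.lintegral_comp (by fun_prop)]
  refine lintegral_congr fun z => ?_
  simp only [Pi.mul_apply]
  rw [← mul_assoc, ← ENNReal.ofReal_mul' (Real.exp_nonneg _), mul_assoc C, ← Real.exp_add]
  have h1 : Φ (flip (leapfrog Φ h z)).1 + ‖(flip (leapfrog Φ h z)).2‖ ^ 2 / 2 =
      Φ z.1 + ‖z.2‖ ^ 2 / 2 + localError Φ h z.1 (leapfrog Φ h z).1 := by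
    rw [← energy_leapfrog]
    simp [flip]
  rw [h1, neg_add (Φ z.1 + _)]

/-- The integral of a function of the two states over independent refreshments of both
velocities. -/
noncomputable def refreshBoth (h γ : ℝ) (F : E d × E d → E d × E d → ENNReal)
    (w w' : E d × E d) : ENNReal :=
  ∫⁻ ξ, ∫⁻ ξ', F (w.1, refresh h γ w.2 ξ) (w'.1, refresh h γ w'.2 ξ')
    ∂(stdGaussian (E d)) ∂(stdGaussian (E d))

theorem measurable_refreshBoth {F : E d × E d → E d × E d → ENNReal}
    (hF : Measurable (Function.uncurry F)) :
    Measurable (Function.uncurry (refreshBoth h γ F)) := by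
  unfold refreshBoth Function.uncurry
  refine Measurable.lintegral_prod_right (f := fun (p : (E d × E d) × (E d × E d)) ξ =>
    ∫⁻ ξ', F (p.1.1, refresh h γ p.1.2 ξ) (p.2.1, refresh h γ p.2.2 ξ') ∂(stdGaussian (E d))) ?_
  refine Measurable.lintegral_prod_right (f := fun (p : ((E d × E d) × (E d × E d)) × E d) ξ' =>
    F (p.1.1.1, refresh h γ p.1.1.2 p.2) (p.1.2.1, refresh h γ p.1.2.2 ξ')) ?_
  refine hF.comp (f := fun p : (((E d × E d) × (E d × E d)) × E d) × E d =>
    ((p.1.1.1.1, refresh h γ p.1.1.1.2 p.1.2), (p.1.1.2.1, refresh h γ p.1.1.2.2 p.2))) ?_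
  unfold refresh
  fun_prop

/-- Flipping a velocity refreshed with `-ξ` is refreshing the flipped velocity with `ξ`; the
Gaussian law is even, and the two noises may be integrated in either order. -/
theorem refreshBoth_flip (F : E d × E d → E d × E d → ENNReal)
    (hF : Measurable (Function.uncurry F)) (w w' : E d × E d) :
    refreshBoth h γ (fun z z' => F (flip z') (flip z)) w w' =
      refreshBoth h γ F (flip w') (flip w) := by
  have hneg : ∀ (a : E d × E d) (ξ : E d),
      flip (a.1, refresh h γ a.2 (-ξ)) = ((flip a).1, refresh h γ (flip a).2 ξ) := by
    intro a ξ
    simp only [refresh, flip, Prod.mk.injEq, true_and]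
    module
  have hm : Measurable fun p : E d × E d =>
      F (flip (w'.1, refresh h γ w'.2 p.1)) (flip (w.1, refresh h γ w.2 p.2)) :=
    hF.comp
      ((measurable_flip.comp (measurable_const.prodMk
        (measurable_refresh_comp measurable_const measurable_fst))).prodMk
      (measurable_flip.comp (measurable_const.prodMk
        (measurable_refresh_comp measurable_const measurable_snd))))
  unfold refreshBoth
  rw [lintegral_lintegral_swap (f := fun ξ ξ' => F (flip (w'.1, refresh h γ w'.2 ξ'))
      (flip (w.1, refresh h γ w.2 ξ))) (hm.comp measurable_swap).aemeasurable,
    ← measurePreserving_neg_stdGaussian.lintegral_comp hm.lintegral_prod_right']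
  refine lintegral_congr fun ξ' => ?_
  have hm' : Measurable fun ξ =>
      F (flip (w'.1, refresh h γ w'.2 (-ξ'))) (flip (w.1, refresh h γ w.2 ξ)) :=
    hF.comp (measurable_const.prodMk (measurable_flip.comp (measurable_const.prodMk
      (measurable_refresh_comp measurable_const measurable_id))))
  refine (measurePreserving_neg_stdGaussian.lintegral_comp hm').symm.trans ?_
  simp only [hneg]

/-- A Gaussian velocity and its refreshment are exchangeable. The velocity after the first
refreshment can thus be taken as the primary variable, with both end velocities as independent
refreshments around a deterministic leapfrog step. -/
theorem lintegral_obabo_eq_refreshBoth (hΦ : ContDiff ℝ 1 Φ) (hhγ : 0 ≤ γ * h)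
    {F : E d × E d → E d × E d → ENNReal} (hF : Measurable (Function.uncurry F)) :
    ∫⁻ z, ∫⁻ z', F z z' ∂(obaboKernel Φ h γ z) ∂(phaseMeasure Φ) =
      ∫⁻ z, refreshBoth h γ F z (leapfrog Φ h z) ∂(phaseMeasure Φ) := by
  have hm := measurable_obabo (h := h) (γ := γ) hΦ
  have hl := measurable_leapfrog (h := h) hΦ
  have hr := measurable_refresh (d := d) (h := h) (γ := γ)
  set η := Real.exp (-(γ * h / 2)) with hη
  have hη1 : η ^ 2 ≤ 1 := pow_le_one₀ (Real.exp_nonneg _) (Real.exp_le_one_iff.2 (by linarith))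
  have hs : η ^ 2 + √(1 - η ^ 2) ^ 2 = 1 := by rw [Real.sq_sqrt (by linarith)]; ring
  have hL : ∀ z, ∫⁻ z', F z z' ∂(obaboKernel Φ h γ z) =
      ∫⁻ ξ, F z (obabo Φ h γ z ξ) ∂((stdGaussian (E d)).prod (stdGaussian (E d))) := fun z =>
    lintegral_obaboKernel hΦ z (hF.comp (measurable_const.prodMk measurable_id))
  simp_rw [hL]
  have hFo : Measurable fun p : (E d × E d) × (E d × E d) => F p.1 (obabo Φ h γ p.1 p.2) :=
    hF.comp (measurable_fst.prodMk hm)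
  rw [phaseMeasure, lintegral_prod _ hFo.lintegral_prod_right'.aemeasurable,
    lintegral_prod (fun z => refreshBoth h γ F z (leapfrog Φ h z))
      ((measurable_refreshBoth hF).comp (measurable_id.prodMk hl)).aemeasurable]
  refine lintegral_congr fun x => ?_
  set g : E d → E d → ENNReal := fun v v' =>
    ∫⁻ ξ', F (x, v) ((leapfrog Φ h (x, v')).1, refresh h γ (leapfrog Φ h (x, v')).2 ξ')
      ∂(stdGaussian (E d)) with hg
  have hgm : Measurable (Function.uncurry g) := by
    refine Measurable.lintegral_prod_right (f := fun (p : E d × E d) ξ' =>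
      F (x, p.1) ((leapfrog Φ h (x, p.2)).1, refresh h γ (leapfrog Φ h (x, p.2)).2 ξ')) ?_
    refine hF.comp (f := fun p : (E d × E d) × E d => ((x, p.1.1),
      ((leapfrog Φ h (x, p.1.2)).1, refresh h γ (leapfrog Φ h (x, p.1.2)).2 p.2))) ?_
    have h1 : Measurable fun p : (E d × E d) × E d => leapfrog Φ h (x, p.1.2) :=
      hl.comp (by fun_prop)
    exact (by fun_prop : Measurable fun p : (E d × E d) × E d => (x, p.1.1)).prodMk
      (h1.fst.prodMk (measurable_refresh_comp h1.snd measurable_snd))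
  have h1 : ∀ v, ∫⁻ ξ, F (x, v) (obabo Φ h γ (x, v) ξ)
      ∂((stdGaussian (E d)).prod (stdGaussian (E d))) =
      ∫⁻ ξ, g v (refresh h γ v ξ) ∂(stdGaussian (E d)) := by
    intro v
    have hx : Measurable fun ξ => F (x, v) (obabo Φ h γ (x, v) ξ) :=
      hFo.comp (measurable_prodMk_left (x := (x, v)))
    rw [lintegral_prod _ hx.aemeasurable]
    simp only [hg, obabo_eq]
  simp_rw [h1]
  change _ = ∫⁻ v, ∫⁻ ξ, g (refresh h γ v ξ) v ∂(stdGaussian (E d)) ∂(stdGaussian (E d))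
  have hk1 : Measurable fun p : E d × E d => g p.1 (refresh h γ p.1 p.2) :=
    hgm.comp (measurable_fst.prodMk hr)
  have hk2 : Measurable fun p : E d × E d => g (refresh h γ p.1 p.2) p.1 :=
    hgm.comp (hr.prodMk measurable_fst)
  rw [← lintegral_prod (fun p : E d × E d => g p.1 (refresh h γ p.1 p.2)) hk1.aemeasurable,
    ← lintegral_prod (fun p : E d × E d => g (refresh h γ p.1 p.2) p.1) hk2.aemeasurable,
    ← (measurePreserving_reflection_stdGaussian hs).lintegral_comp hk1]
  refine lintegral_congr fun p => ?_
  -- Refreshment is the first component of the reflection, which is an involution: applied to the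
  -- reflected pair it restores the original velocity.
  have h2 : refresh h γ (η • p.1 + √(1 - η ^ 2) • p.2) (√(1 - η ^ 2) • p.1 - η • p.2) = p.1 := by
    simp only [refresh, ← hη]
    have h3 : η • (η • p.1 + √(1 - η ^ 2) • p.2) + √(1 - η ^ 2) • (√(1 - η ^ 2) • p.1 - η • p.2)
        = (η ^ 2 + √(1 - η ^ 2) ^ 2) • p.1 := by module
    rw [h3, hs, one_smul]
  rw [h2]
  rfl

/-- Time reversal of one step of the Langevin dynamics: up to a flip of the velocities, the
energy error is the log-ratio of the laws of the backward and forward steps. -/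
theorem lintegral_obabo_reversal (hΦ : ContDiff ℝ 1 Φ) (hhγ : 0 ≤ γ * h)
    {F : E d × E d → E d × E d → ENNReal} (hF : Measurable (Function.uncurry F)) :
    ∫⁻ z, ∫⁻ z', F z z' ∂(obaboKernel Φ h γ z) ∂(phaseMeasure Φ) =
      ∫⁻ z, ∫⁻ z', ENNReal.ofReal (Real.exp (-localError Φ h z.1 z'.1)) * F (flip z') (flip z)
        ∂(obaboKernel Φ h γ z) ∂(phaseMeasure Φ) := by
  have hl := measurable_leapfrog (h := h) hΦ
  have hf := measurable_flip (d := d)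
  have hE := measurable_localError (h := h) hΦ
  have hFf : Measurable (Function.uncurry fun z z' => F (flip z') (flip z)) :=
    hF.comp ((hf.comp measurable_snd).prodMk (hf.comp measurable_fst))
  have hEF : Measurable (Function.uncurry fun z z' : E d × E d =>
      ENNReal.ofReal (Real.exp (-localError Φ h z.1 z'.1)) * F (flip z') (flip z)) := by
    refine Measurable.mul ?_ hFf
    have : Measurable fun p : (E d × E d) × (E d × E d) => localError Φ h p.1.1 p.2.1 :=
      hE.comp (measurable_fst.fst.prodMk measurable_snd.fst)
    fun_prop
  rw [lintegral_obabo_eq_refreshBoth hΦ hhγ hF, lintegral_obabo_eq_refreshBoth hΦ hhγ hEF,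
    lintegral_phaseMeasure_leapfrog (h := h) hΦ
      (k := fun z => refreshBoth h γ F z (leapfrog Φ h z)) ((measurable_refreshBoth hF).comp (measurable_id.prodMk hl))]
  refine lintegral_congr fun z => ?_
  -- After the change of variables the leapfrog pair is `(flip (leapfrog z), flip z)`: the original
  -- pair, flipped and in reverse order.
  rw [flip_leapfrog_flip_leapfrog, ← refreshBoth_flip F hF]
  simp only [refreshBoth]
  rw [← lintegral_const_mul' _ _ ENNReal.ofReal_ne_top]
  refine lintegral_congr fun ξ => ?_
  rw [← lintegral_const_mul' _ _ ENNReal.ofReal_ne_top]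

end Dynamics


/-! ### Time reversal of whole trajectories -/

section Trajectory

variable {d : ℕ} {Φ : E d → ℝ} {h γ : ℝ}

theorem measurable_localError_comp (hΦ : ContDiff ℝ 1 Φ) {α : Type*} [MeasurableSpace α]
    {f g : α → E d} (hf : Measurable f) (hg : Measurable g) :
    Measurable fun a => localError Φ h (f a) (g a) :=
  (measurable_localError hΦ).comp (hf.prodMk hg)

theorem measurable_stepMap (hΦ : ContDiff ℝ 1 Φ) :
    Measurable fun p : ((E d × E d) × ℝ) × (E d × E d) =>
      (p.2, p.1.2 + localError Φ h p.1.1.1 p.2.1) :=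
  measurable_snd.prodMk (measurable_fst.snd.add
    (measurable_localError_comp hΦ measurable_fst.fst.fst measurable_snd.fst))

theorem isMarkovKernel_stepKernel (hΦ : ContDiff ℝ 1 Φ) :
    IsMarkovKernel (stepKernel Φ h γ) := by
  have := isMarkovKernel_obaboKernel (h := h) (γ := γ) hΦ
  unfold stepKernel
  exact Kernel.IsMarkovKernel.map _ (measurable_stepMap hΦ)

theorem lintegral_stepKernel (hΦ : ContDiff ℝ 1 Φ) (p : (E d × E d) × ℝ)
    {G : (E d × E d) × ℝ → ENNReal} (hG : Measurable G) :
    ∫⁻ q, G q ∂(stepKernel Φ h γ p) =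
      ∫⁻ z', G (z', p.2 + localError Φ h p.1.1 z'.1) ∂(obaboKernel Φ h γ p.1) := by
  have := isMarkovKernel_obaboKernel (h := h) (γ := γ) hΦ
  have hm := measurable_stepMap (h := h) hΦ
  have hGm : Measurable fun p : ((E d × E d) × ℝ) × (E d × E d) =>
      G (p.2, p.1.2 + localError Φ h p.1.1.1 p.2.1) := hG.comp hm
  rw [stepKernel, Kernel.map_apply _ hm, lintegral_map hG hm, Kernel.prod_apply,
    Kernel.id_apply, Kernel.comap_apply, lintegral_prod _ hGm.aemeasurable,
    lintegral_dirac' _ hGm.lintegral_prod_right']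

theorem lintegral_pow_succ {α : Type*} [MeasurableSpace α] (κ : Kernel α α) (n : ℕ) (a : α)
    {f : α → ENNReal} (hf : Measurable f) :
    ∫⁻ b, f b ∂((κ ^ (n + 1)) a) = ∫⁻ b, ∫⁻ c, f c ∂((κ ^ n) b) ∂(κ a) := by
  rw [pow_succ]
  exact Kernel.lintegral_comp _ _ _ hf

theorem lintegral_pow_succ' {α : Type*} [MeasurableSpace α] (κ : Kernel α α) (n : ℕ) (a : α)
    {f : α → ENNReal} (hf : Measurable f) :
    ∫⁻ b, f b ∂((κ ^ (n + 1)) a) = ∫⁻ b, ∫⁻ c, f c ∂(κ b) ∂((κ ^ n) a) := by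
  rw [pow_succ']
  exact Kernel.lintegral_comp _ _ _ hf

theorem lintegral_pow_zero {α : Type*} [MeasurableSpace α] (κ : Kernel α α) (a : α)
    {f : α → ENNReal} (hf : Measurable f) : ∫⁻ b, f b ∂((κ ^ 0) a) = f a := by
  change ∫⁻ b, f b ∂(Kernel.id a) = f a
  rw [Kernel.id_apply, lintegral_dirac' _ hf]

/-- The energy errors accumulated by the trajectory do not depend on their initial value. -/
theorem lintegral_stepKernel_pow_shift (hΦ : ContDiff ℝ 1 Φ) (n : ℕ) (z : E d × E d) (a : ℝ)
    {G : (E d × E d) × ℝ → ENNReal} (hG : Measurable G) :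
    ∫⁻ q, G q ∂((stepKernel Φ h γ ^ n) (z, a)) =
      ∫⁻ q, G (q.1, a + q.2) ∂((stepKernel Φ h γ ^ n) (z, 0)) := by
  have hsh : ∀ a : ℝ, Measurable fun q : (E d × E d) × ℝ => G (q.1, a + q.2) := fun a =>
    hG.comp (measurable_fst.prodMk (measurable_snd.const_add a))
  induction n generalizing z a G with
  | zero => rw [lintegral_pow_zero _ _ hG, lintegral_pow_zero _ _ (hsh a), add_zero]
  | succ n ih =>
    rw [lintegral_pow_succ _ _ _ hG, lintegral_pow_succ _ _ _ (hsh a),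
      lintegral_stepKernel hΦ _ hG.lintegral_kernel,
      lintegral_stepKernel hΦ _ (hsh a).lintegral_kernel]
    refine lintegral_congr fun z' => ?_
    simp only
    rw [ih z' _ hG hsh, ih z' _ (hsh a)
      fun b => (hsh a).comp (measurable_fst.prodMk (measurable_snd.const_add b))]
    refine lintegral_congr fun q => ?_
    simp only [zero_add, add_assoc]

theorem measurable_lintegral_kernel_comp {α β δ : Type*} [MeasurableSpace α] [MeasurableSpace β]
    [MeasurableSpace δ] (κ : Kernel α β) [IsSFiniteKernel κ] {f : δ → α} (hf : Measurable f)
    {F : δ → β → ENNReal} (hF : Measurable (Function.uncurry F)) :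
    Measurable fun x => ∫⁻ b, F x b ∂(κ (f x)) := by
  have := Measurable.lintegral_kernel_prod_right (κ := κ.comap f hf) hF
  simpa only [Kernel.comap_apply] using this

/-- Time reversal of the Langevin trajectory: up to a flip of the velocities, the accumulated
energy error is the log-ratio of the laws of the backward and forward trajectories. -/
theorem lintegral_trajectory_reversal (hΦ : ContDiff ℝ 1 Φ) (hhγ : 0 ≤ γ * h) (n : ℕ)
    {G : E d × E d → (E d × E d) × ℝ → ENNReal} (hG : Measurable (Function.uncurry G)) :
    ∫⁻ z, ∫⁻ q, G z q ∂((stepKernel Φ h γ ^ n) (z, 0)) ∂(phaseMeasure Φ) =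
      ∫⁻ z, ∫⁻ q, ENNReal.ofReal (Real.exp (-q.2)) * G (flip q.1) (flip z, -q.2)
        ∂((stepKernel Φ h γ ^ n) (z, 0)) ∂(phaseMeasure Φ) := by
  have hQ := isMarkovKernel_obaboKernel (h := h) (γ := γ) hΦ
  have hS := isMarkovKernel_stepKernel (h := h) (γ := γ) hΦ
  have hrev : ∀ {G : E d × E d → (E d × E d) × ℝ → ENNReal}, Measurable (Function.uncurry G) →
      Measurable (Function.uncurry fun (z : E d × E d) (q : (E d × E d) × ℝ) =>
        ENNReal.ofReal (Real.exp (-q.2)) * G (flip q.1) (flip z, -q.2)) := by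
    intro G hG
    refine Measurable.mul (by fun_prop) (hG.comp (f := fun p : (E d × E d) × (E d × E d) × ℝ =>
      (flip p.2.1, (flip p.1, -p.2.2))) (by fun_prop))
  have hz : ∀ {G : E d × E d → (E d × E d) × ℝ → ENNReal}, Measurable (Function.uncurry G) →
      ∀ z, Measurable (G z) := fun hG z => hG.of_uncurry_left
  induction n generalizing G with
  | zero =>
    simp_rw [lintegral_pow_zero _ _ (hz hG _), lintegral_pow_zero _ _ (hz (hrev hG) _)]
    have hm : Measurable fun z : E d × E d => G z (z, 0) :=
      hG.comp (measurable_id.prodMk (measurable_id.prodMk measurable_const))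
    rw [← (measurePreserving_flip Φ).lintegral_comp hm]
    simp
  | succ n ih =>
    -- `G'` integrates out the last step, so that the induction hypothesis reverses the first `n`.
    -- What remains, `F` below, is a function of a single step, to which the one-step reversal
    -- applies; that step becomes the first one of the reversed trajectory.
    set G' : E d × E d → (E d × E d) × ℝ → ENNReal := fun z q =>
      ∫⁻ z', G z (z', q.2 + localError Φ h q.1.1 z'.1) ∂(obaboKernel Φ h γ q.1) with hG'
    have hG'm : Measurable (Function.uncurry G') := by
      refine measurable_lintegral_kernel_comp (obaboKernel Φ h γ)
        (f := fun p : (E d × E d) × (E d × E d) × ℝ => p.2.1) (by fun_prop)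
        (F := fun p z' => G p.1 (z', p.2.2 + localError Φ h p.2.1.1 z'.1)) ?_
      exact hG.comp (measurable_fst.fst.prodMk (measurable_snd.prodMk
        (measurable_fst.snd.snd.add (measurable_localError_comp hΦ measurable_fst.snd.fst.fst
          measurable_snd.fst))))
    set F : E d × E d → E d × E d → ENNReal := fun z z' =>
      ∫⁻ q, ENNReal.ofReal (Real.exp (-q.2)) *
        G (flip q.1) (z', -q.2 + localError Φ h z.1 z'.1)
        ∂((stepKernel Φ h γ ^ n) (flip z, 0)) with hF
    have hFi : Measurable fun p : ((E d × E d) × (E d × E d)) × (E d × E d) × ℝ =>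
        ENNReal.ofReal (Real.exp (-p.2.2)) *
          G (flip p.2.1) (p.1.2, -p.2.2 + localError Φ h p.1.1.1 p.1.2.1) := by
      refine Measurable.mul (by fun_prop) (hG.comp ((measurable_flip.comp
        measurable_snd.fst).prodMk (measurable_fst.snd.prodMk (measurable_snd.snd.neg.add
          (measurable_localError_comp hΦ measurable_fst.fst.fst measurable_fst.snd.fst)))))
    have hFm : Measurable (Function.uncurry F) := by
      refine measurable_lintegral_kernel_comp (stepKernel Φ h γ ^ n)
        (f := fun p : (E d × E d) × (E d × E d) => (flip p.1, (0 : ℝ))) (by fun_prop)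
        (F := fun p q => ENNReal.ofReal (Real.exp (-q.2)) *
          G (flip q.1) (p.2, -q.2 + localError Φ h p.1.1 p.2.1)) hFi
    have e1 : ∀ z, ∫⁻ q, G z q ∂((stepKernel Φ h γ ^ (n + 1)) (z, 0)) =
        ∫⁻ q, G' z q ∂((stepKernel Φ h γ ^ n) (z, 0)) := by
      intro z
      rw [lintegral_pow_succ' _ _ _ (hz hG z)]
      exact lintegral_congr fun q => lintegral_stepKernel hΦ q (hz hG z)
    have e2 : ∀ z, ∫⁻ q, ENNReal.ofReal (Real.exp (-q.2)) * G' (flip q.1) (flip z, -q.2)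
        ∂((stepKernel Φ h γ ^ n) (z, 0)) =
        ∫⁻ z', F (flip z) z' ∂(obaboKernel Φ h γ (flip z)) := by
      intro z
      simp only [hG', hF, flip_flip]
      simp_rw [← lintegral_const_mul' _ _ ENNReal.ofReal_ne_top]
      refine lintegral_lintegral_swap (Measurable.aemeasurable ?_)
      exact hFi.comp (f := fun p : ((E d × E d) × ℝ) × (E d × E d) => ((flip z, p.2), p.1))
        (by fun_prop)
    have e3 : ∀ z, ∫⁻ q, ENNReal.ofReal (Real.exp (-q.2)) * G (flip q.1) (flip z, -q.2)
        ∂((stepKernel Φ h γ ^ (n + 1)) (z, 0)) =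
        ∫⁻ z', ENNReal.ofReal (Real.exp (-localError Φ h z.1 z'.1)) * F (flip z') (flip z)
          ∂(obaboKernel Φ h γ z) := by
      intro z
      rw [lintegral_pow_succ _ _ _ (hz (hrev hG) z),
        lintegral_stepKernel hΦ _ (hz (hrev hG) z).lintegral_kernel]
      refine lintegral_congr fun z' => ?_
      rw [lintegral_stepKernel_pow_shift hΦ n _ _ (hz (hrev hG) z)]
      simp only [hF, flip_flip, flip_fst]
      rw [← lintegral_const_mul' _ _ ENNReal.ofReal_ne_top]
      refine lintegral_congr fun q => ?_
      rw [localError_symm z.1, zero_add, neg_add, Real.exp_add, ENNReal.ofReal_mul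
        (Real.exp_nonneg _), mul_assoc, add_comm (-q.2)]
    have hFQ : Measurable fun z => ∫⁻ z', F z z' ∂(obaboKernel Φ h γ z) :=
      hFm.lintegral_kernel_prod_right'
    simp_rw [e1, e3]
    rw [ih hG'm]
    simp_rw [e2]
    rw [(measurePreserving_flip Φ).lintegral_comp hFQ, lintegral_obabo_reversal hΦ hhγ hFm]

end Trajectory


/-! ### Null sets, detailed balance and the accept–reject test -/

section Malt

variable {d : ℕ} {Φ : E d → ℝ} {h T γ : ℝ}

theorem stdGaussian_preimage_affine_eq_zero_iff (b : E d) {c : ℝ} (hc : c ≠ 0) (A : Set (E d)) :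
    stdGaussian (E d) {ξ | b + c • ξ ∈ A} = 0 ↔ volume A = 0 := by
  have hvol : volume {ξ : E d | b + c • ξ ∈ A} = 0 ↔ volume A = 0 := by
    have h1 : {ξ : E d | b + c • ξ ∈ A} = (c • ·) ⁻¹' ((b + ·) ⁻¹' A) := rfl
    rw [h1, Measure.addHaar_preimage_smul _ hc, measure_preimage_add, mul_eq_zero]
    simp [hc]
  rw [← hvol]
  exact ⟨fun h0 => volume_absolutelyContinuous_stdGaussian h0,
    fun h0 => stdGaussian_absolutelyContinuous h0⟩

/-- The new position is affine in the first Gaussian draw, with slope `h * √(1 - η ^ 2)`, nonzero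
because positive friction gives `η < 1`. -/
theorem stepKernel_position_eq_zero_iff (hΦ : ContDiff ℝ 1 Φ) (hγ : 0 < γ) (hh : 0 < h)
    (p : (E d × E d) × ℝ) {A : Set (E d)} (hA : MeasurableSet A) :
    stepKernel Φ h γ p {q | q.1.1 ∈ A} = 0 ↔ volume A = 0 := by
  have hmA : MeasurableSet {q : (E d × E d) × ℝ | q.1.1 ∈ A} := measurable_fst.fst hA
  have hmA' : MeasurableSet {z : E d × E d | z.1 ∈ A} := measurable_fst hA
  set η := Real.exp (-(γ * h / 2)) with hη
  have hη1 : η ^ 2 < 1 := pow_lt_one₀ (Real.exp_nonneg _)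
    (by rw [← Real.exp_zero]; exact Real.exp_lt_exp.2 (by have := mul_pos hγ hh; linarith)) two_ne_zero
  have hs : h * √(1 - η ^ 2) ≠ 0 := by
    have : 0 < √(1 - η ^ 2) := Real.sqrt_pos.2 (by linarith)
    positivity
  set b : E d := h • (-((h / 2) • gradient Φ p.1.1) + η • p.1.2) + p.1.1 with hb
  have hpos : ∀ ξ : E d × E d, (obabo Φ h γ p.1 ξ).1 = b + (h * √(1 - η ^ 2)) • ξ.1 := by
    intro ξ
    simp only [obabo, ← hη, hb]
    module
  have hpre : (Prod.fst ⁻¹' {ξ : E d | b + (h * √(1 - η ^ 2)) • ξ ∈ A} : Set (E d × E d)) =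
      {ξ | (obabo Φ h γ p.1 ξ).1 ∈ A} := by
    ext ξ
    simp [hpos]
  have hmB : MeasurableSet {ξ : E d | b + (h * √(1 - η ^ 2)) • ξ ∈ A} :=
    (by fun_prop : Measurable fun ξ : E d => b + (h * √(1 - η ^ 2)) • ξ) hA
  have key : stepKernel Φ h γ p {q | q.1.1 ∈ A} =
      stdGaussian (E d) {ξ | b + (h * √(1 - η ^ 2)) • ξ ∈ A} := by
    rw [← lintegral_indicator_one hmA, lintegral_stepKernel hΦ p (measurable_one.indicator hmA)]
    have e1 : ∀ z' : E d × E d, ({q : (E d × E d) × ℝ | q.1.1 ∈ A}.indicator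
        (1 : (E d × E d) × ℝ → ENNReal)) (z', p.2 + localError Φ h p.1.1 z'.1) =
        {z : E d × E d | z.1 ∈ A}.indicator 1 z' := fun z' => rfl
    simp_rw [e1]
    rw [lintegral_obaboKernel hΦ p.1 (measurable_one.indicator hmA')]
    have e2 : ∀ ξ : E d × E d, ({z : E d × E d | z.1 ∈ A}.indicator (1 : E d × E d → ENNReal))
        (obabo Φ h γ p.1 ξ) =
        (Prod.fst ⁻¹' {ξ : E d | b + (h * √(1 - η ^ 2)) • ξ ∈ A}).indicator 1 ξ := by
      intro ξ
      rw [hpre]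
      rfl
    simp_rw [e2]
    rw [lintegral_indicator_one (measurable_fst hmB),
      (measurePreserving_fst (μ := stdGaussian (E d)) (ν := stdGaussian (E d))).measure_preimage
        hmB.nullMeasurableSet]
  rw [key]
  exact stdGaussian_preimage_affine_eq_zero_iff b hs A

theorem isMarkovKernel_proposalKernel (hΦ : ContDiff ℝ 1 Φ) (L : ℕ) :
    IsMarkovKernel (proposalKernel Φ h γ L) := by
  have := isMarkovKernel_stepKernel (h := h) (γ := γ) hΦ
  have : IsMarkovKernel ((Kernel.id ×ₖ Kernel.const (E d) (stdGaussian (E d))).map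
      fun z : E d × E d => (z, (0 : ℝ))) := Kernel.IsMarkovKernel.map _ (by fun_prop)
  unfold proposalKernel
  infer_instance

theorem lintegral_proposalKernel (L : ℕ) (x : E d)
    {G : (E d × E d) × ℝ → ENNReal} (hG : Measurable G) :
    ∫⁻ q, G q ∂(proposalKernel Φ h γ L x) =
      ∫⁻ v, ∫⁻ q, G q ∂((stepKernel Φ h γ ^ L) ((x, v), 0)) ∂(stdGaussian (E d)) := by
  have hm : Measurable fun z : E d × E d => (z, (0 : ℝ)) := by fun_prop
  have hGm : Measurable fun z : E d × E d => ∫⁻ q, G q ∂((stepKernel Φ h γ ^ L) (z, 0)) :=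
    hG.lintegral_kernel.comp hm
  rw [proposalKernel, Kernel.lintegral_comp _ _ _ hG, Kernel.map_apply _ hm,
    lintegral_map hG.lintegral_kernel hm, Kernel.prod_apply, Kernel.id_apply, Kernel.const_apply,
    lintegral_prod _ hGm.aemeasurable, lintegral_dirac' _ hGm.lintegral_prod_right']

/-- Only the last step matters: whatever the earlier states and the error, its position has the null
sets of Lebesgue measure. -/
theorem proposalKernel_position_eq_zero_iff (hΦ : ContDiff ℝ 1 Φ) (hγ : 0 < γ) (hh : 0 < h)
    {L : ℕ} (hL : L ≠ 0) (x : E d) {A : Set (E d)} (hA : MeasurableSet A) :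
    proposalKernel Φ h γ L x {q | q.1.1 ∈ A} = 0 ↔ volume A = 0 := by
  obtain ⟨n, rfl⟩ := Nat.exists_eq_succ_of_ne_zero hL
  have hS := isMarkovKernel_stepKernel (h := h) (γ := γ) hΦ
  have hP := isMarkovKernel_proposalKernel (h := h) (γ := γ) hΦ n
  have hmA : MeasurableSet {q : (E d × E d) × ℝ | q.1.1 ∈ A} := measurable_fst.fst hA
  have key : proposalKernel Φ h γ (n + 1) x {q | q.1.1 ∈ A} =
      ∫⁻ p, stepKernel Φ h γ p {q | q.1.1 ∈ A} ∂(proposalKernel Φ h γ n x) := by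
    have : proposalKernel Φ h γ (n + 1) = stepKernel Φ h γ ∘ₖ proposalKernel Φ h γ n := by
      rw [proposalKernel, proposalKernel, pow_succ', ← Kernel.comp_assoc]
      rfl
    rw [this, Kernel.comp_apply' _ _ _ hmA]
  rw [key, lintegral_eq_zero_iff ((stepKernel Φ h γ).measurable_coe hmA)]
  constructor
  · intro h0
    obtain ⟨p, hp⟩ := h0.exists
    exact (stepKernel_position_eq_zero_iff hΦ hγ hh p hA).1 hp
  · intro h0
    exact Eventually.of_forall fun p => (stepKernel_position_eq_zero_iff hΦ hγ hh p hA).2 h0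

theorem acceptProb_pos (Δ : ℝ) : 0 < acceptProb Δ := lt_min one_pos (Real.exp_pos _)

theorem acceptProb_le_one (Δ : ℝ) : acceptProb Δ ≤ 1 := min_le_left _ _

@[fun_prop]
theorem measurable_acceptProb : Measurable acceptProb := by unfold acceptProb; fun_prop

/-- The Metropolis identity: weighting the backward acceptance by the likelihood ratio gives the
forward acceptance. -/
theorem exp_neg_mul_acceptProb_neg (Δ : ℝ) :
    Real.exp (-Δ) * acceptProb (-Δ) = acceptProb Δ := by
  rw [acceptProb, acceptProb, mul_min_of_nonneg _ _ (Real.exp_nonneg _), mul_one, ← Real.exp_add,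
    neg_neg, neg_add_cancel, Real.exp_zero, min_comm]

instance isMarkovKernel_acceptKernel (d : ℕ) : IsMarkovKernel (acceptKernel d) := by
  refine ⟨fun p => ⟨?_⟩⟩
  change (ENNReal.ofReal (acceptProb p.2.2) • Measure.dirac p.2.1.1
    + ENNReal.ofReal (1 - acceptProb p.2.2) • Measure.dirac p.1) Set.univ = 1
  simp only [Measure.coe_add, Measure.coe_smul, Pi.add_apply, Pi.smul_apply, smul_eq_mul,
    measure_univ, mul_one]
  rw [← ENNReal.ofReal_add (acceptProb_pos _).le (sub_nonneg.2 (acceptProb_le_one _)),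
    add_sub_cancel, ENNReal.ofReal_one]

theorem isMarkovKernel_maltKernel (hΦ : ContDiff ℝ 1 Φ) :
    IsMarkovKernel (maltKernel Φ h T γ) := by
  have := isMarkovKernel_proposalKernel (h := h) (γ := γ) hΦ ⌊T / h⌋₊
  unfold maltKernel
  infer_instance

/-- The part of the transition law of the algorithm due to accepted proposals. -/
noncomputable def acceptedLaw (Φ : E d → ℝ) (h T γ : ℝ) (x : E d) : Measure (E d) :=
  ((proposalKernel Φ h γ ⌊T / h⌋₊ x).withDensity fun q => ENNReal.ofReal (acceptProb q.2)).map
    fun q => q.1.1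

/-- The probability that the proposal is rejected. -/
noncomputable def rejectProb (Φ : E d → ℝ) (h T γ : ℝ) (x : E d) : ENNReal :=
  ∫⁻ q, ENNReal.ofReal (1 - acceptProb q.2) ∂(proposalKernel Φ h γ ⌊T / h⌋₊ x)

theorem lintegral_acceptedLaw (x : E d) {w : E d → ENNReal} (hw : Measurable w) :
    ∫⁻ y, w y ∂(acceptedLaw Φ h T γ x) =
      ∫⁻ q, ENNReal.ofReal (acceptProb q.2) * w q.1.1 ∂(proposalKernel Φ h γ ⌊T / h⌋₊ x) := by
  rw [acceptedLaw, lintegral_map hw (by fun_prop),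
    lintegral_withDensity_eq_lintegral_mul _ (by fun_prop) (by fun_prop)]
  rfl

theorem maltKernel_apply (hΦ : ContDiff ℝ 1 Φ) (x : E d) : maltKernel Φ h T γ x =
    rejectProb Φ h T γ x • Measure.dirac x + acceptedLaw Φ h T γ x := by
  have := isMarkovKernel_proposalKernel (h := h) (γ := γ) hΦ ⌊T / h⌋₊
  ext A hA
  have hmA : Measurable (A.indicator (1 : E d → ENNReal)) := measurable_one.indicator hA
  have hacc : ∀ p : E d × (E d × E d) × ℝ, acceptKernel d p A =
      ENNReal.ofReal (acceptProb p.2.2) * A.indicator 1 p.2.1.1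
        + ENNReal.ofReal (1 - acceptProb p.2.2) * A.indicator 1 p.1 := by
    intro p
    change (ENNReal.ofReal (acceptProb p.2.2) • Measure.dirac p.2.1.1
      + ENNReal.ofReal (1 - acceptProb p.2.2) • Measure.dirac p.1) A = _
    simp only [Measure.coe_add, Measure.coe_smul, Pi.add_apply, Pi.smul_apply, smul_eq_mul,
      Measure.dirac_apply' _ hA]
  have hma := (acceptKernel d).measurable_coe hA
  rw [maltKernel, Kernel.comp_apply' _ _ _ hA, Kernel.prod_apply, Kernel.id_apply,
    lintegral_prod _ hma.aemeasurable, lintegral_dirac' _ hma.lintegral_prod_right']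
  simp_rw [hacc]
  rw [lintegral_add_left (by fun_prop), lintegral_mul_const _ (by fun_prop),
    ← lintegral_acceptedLaw x hmA, lintegral_indicator_one hA, Measure.add_apply,
    Measure.smul_apply, Measure.dirac_apply' _ hA, smul_eq_mul, add_comm]
  rfl

/-- Weighting by an everywhere positive acceptance probability creates no new null sets. The
assumption `h ≤ T` guarantees at least one step. -/
theorem acceptedLaw_eq_zero_iff (hΦ : ContDiff ℝ 1 Φ) (hγ : 0 < γ) (hh : 0 < h) (hT : h ≤ T)
    (x : E d) {A : Set (E d)} (hA : MeasurableSet A) :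
    acceptedLaw Φ h T γ x A = 0 ↔ volume A = 0 := by
  have hL : ⌊T / h⌋₊ ≠ 0 := by
    rw [← Nat.pos_iff_ne_zero, Nat.floor_pos, le_div_iff₀ hh, one_mul]
    exact hT
  rw [← proposalKernel_position_eq_zero_iff hΦ hγ hh hL x hA, acceptedLaw,
    Measure.map_apply (by fun_prop) hA]
  refine ⟨fun h0 => ?_, fun h0 => withDensity_absolutelyContinuous _ _ h0⟩
  refine withDensity_absolutelyContinuous' (by fun_prop) (Eventually.of_forall fun q => ?_) h0
  simp only [ne_eq, ENNReal.ofReal_eq_zero, not_le]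
  exact acceptProb_pos _

theorem rejectProb_lt_one (hΦ : ContDiff ℝ 1 Φ) (hγ : 0 < γ) (hh : 0 < h) (hT : h ≤ T)
    (x : E d) : rejectProb Φ h T γ x < 1 := by
  have := isMarkovKernel_maltKernel (h := h) (T := T) (γ := γ) hΦ
  have h1 : maltKernel Φ h T γ x Set.univ = 1 := measure_univ
  have h2 : acceptedLaw Φ h T γ x Set.univ ≠ 0 := fun h0 =>
    NeZero.ne (volume (Set.univ : Set (E d)))
      ((acceptedLaw_eq_zero_iff hΦ hγ hh hT x MeasurableSet.univ).1 h0)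
  rw [maltKernel_apply hΦ] at h1
  simp only [Measure.coe_add, Measure.coe_smul, Pi.add_apply, Pi.smul_apply, smul_eq_mul,
    measure_univ, mul_one] at h1
  have h3 : rejectProb Φ h T γ x ≠ ⊤ := fun h0 => by simp [h0] at h1
  rw [← h1]
  exact ENNReal.lt_add_right h3 h2

theorem volume_absolutelyContinuous_acceptedLaw (hΦ : ContDiff ℝ 1 Φ) (hγ : 0 < γ) (hh : 0 < h)
    (hT : h ≤ T) (x : E d) : volume ≪ acceptedLaw Φ h T γ x :=
  Measure.AbsolutelyContinuous.mk fun _ hA => (acceptedLaw_eq_zero_iff hΦ hγ hh hT x hA).1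

theorem acceptedLaw_absolutelyContinuous (hΦ : ContDiff ℝ 1 Φ) (hγ : 0 < γ) (hh : 0 < h)
    (hT : h ≤ T) (x : E d) : acceptedLaw Φ h T γ x ≪ volume :=
  Measure.AbsolutelyContinuous.mk fun _ hA => (acceptedLaw_eq_zero_iff hΦ hγ hh hT x hA).2

theorem target_absolutelyContinuous (Φ : E d → ℝ) : target Φ ≪ volume :=
  (withDensity_absolutelyContinuous _ _).smul_left _

theorem volume_absolutelyContinuous_target (hΦ : ContDiff ℝ 1 Φ)
    (hint : Integrable (fun x => Real.exp (-Φ x)) volume) : volume ≪ target Φ := by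
  have hc := hΦ.continuous.measurable
  have hfin : ∫⁻ x, ENNReal.ofReal (Real.exp (-Φ x)) ≠ ⊤ :=
    (hint.lintegral_lt_top).ne
  refine (withDensity_absolutelyContinuous' (f := fun x => ENNReal.ofReal (Real.exp (-Φ x)))
    (by fun_prop) (Eventually.of_forall fun x => ?_)).trans
    (Measure.absolutelyContinuous_smul (ENNReal.inv_ne_zero.2 hfin))
  simp only [ne_eq, ENNReal.ofReal_eq_zero, not_le]
  positivity

theorem isProbabilityMeasure_target (hΦ : ContDiff ℝ 1 Φ)
    (hint : Integrable (fun x => Real.exp (-Φ x)) volume) : IsProbabilityMeasure (target Φ) := by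
  have hc := hΦ.continuous.measurable
  have hfin : ∫⁻ x, ENNReal.ofReal (Real.exp (-Φ x)) ≠ ⊤ := (hint.lintegral_lt_top).ne
  have hne : ∫⁻ x, ENNReal.ofReal (Real.exp (-Φ x)) ≠ 0 := by
    rw [← setLIntegral_univ, ← withDensity_apply _ MeasurableSet.univ]
    intro h0
    refine NeZero.ne (volume (Set.univ : Set (E d))) ?_
    refine withDensity_absolutelyContinuous' (f := fun x => ENNReal.ofReal (Real.exp (-Φ x)))
      (by fun_prop) (Eventually.of_forall fun x => ?_) h0
    simp only [ne_eq, ENNReal.ofReal_eq_zero, not_le]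
    positivity
  refine ⟨?_⟩
  rw [target, Measure.smul_apply, withDensity_apply _ MeasurableSet.univ, setLIntegral_univ,
    smul_eq_mul, ENNReal.inv_mul_cancel hne hfin]

theorem lintegral_maltKernel (hΦ : ContDiff ℝ 1 Φ) (x : E d) {w : E d → ENNReal}
    (hw : Measurable w) : ∫⁻ y, w y ∂(maltKernel Φ h T γ x) = rejectProb Φ h T γ x * w x +
      ∫⁻ v, ∫⁻ q, ENNReal.ofReal (acceptProb q.2) * w q.1.1
        ∂((stepKernel Φ h γ ^ ⌊T / h⌋₊) ((x, v), 0)) ∂(stdGaussian (E d)) := by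
  rw [maltKernel_apply hΦ, lintegral_add_measure, lintegral_smul_measure,
    lintegral_dirac' _ hw, lintegral_acceptedLaw x hw,
    lintegral_proposalKernel _ _ (by fun_prop), smul_eq_mul]

theorem measurable_rejectProb : Measurable (rejectProb Φ h T γ) := by
  unfold rejectProb
  exact Measurable.lintegral_kernel (by fun_prop)

/-- Detailed balance for the algorithm. -/
theorem lintegral_maltKernel_symm (hΦ : ContDiff ℝ 1 Φ) (hγ : 0 < γ) (hh : 0 < h)
    {u : E d × E d → ENNReal} (hu : Measurable u) :
    ∫⁻ x, ∫⁻ y, u (x, y) ∂(maltKernel Φ h T γ x)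
        ∂((volume : Measure (E d)).withDensity fun x => ENNReal.ofReal (Real.exp (-Φ x))) =
      ∫⁻ x, ∫⁻ y, u (y, x) ∂(maltKernel Φ h T γ x)
        ∂((volume : Measure (E d)).withDensity fun x => ENNReal.ofReal (Real.exp (-Φ x))) := by
  have hS := isMarkovKernel_stepKernel (h := h) (γ := γ) hΦ
  have hr := measurable_rejectProb (Φ := Φ) (h := h) (T := T) (γ := γ)
  set L := ⌊T / h⌋₊ with hL
  have hmeas : ∀ {u : E d × E d → ENNReal}, Measurable u →
      Measurable (Function.uncurry fun (z : E d × E d) (q : (E d × E d) × ℝ) =>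
        ENNReal.ofReal (acceptProb q.2) * u (z.1, q.1.1)) := fun hu => by
    unfold Function.uncurry; fun_prop
  -- Rejections contribute only on the diagonal, where swapping the states changes nothing; accepted
  -- moves become an integral over phase space.
  have hpair : ∀ {u : E d × E d → ENNReal}, Measurable u →
      ∫⁻ x, ∫⁻ y, u (x, y) ∂(maltKernel Φ h T γ x)
        ∂((volume : Measure (E d)).withDensity fun x => ENNReal.ofReal (Real.exp (-Φ x))) =
      ∫⁻ x, rejectProb Φ h T γ x * u (x, x)
        ∂((volume : Measure (E d)).withDensity fun x => ENNReal.ofReal (Real.exp (-Φ x))) +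
      ∫⁻ z, ∫⁻ q, ENNReal.ofReal (acceptProb q.2) * u (z.1, q.1.1)
        ∂((stepKernel Φ h γ ^ L) (z, 0)) ∂(phaseMeasure Φ) := by
    intro u hu
    have hux : ∀ x, Measurable fun y => u (x, y) := fun x => hu.comp measurable_prodMk_left
    have hmz : Measurable fun z : E d × E d => ∫⁻ q, ENNReal.ofReal (acceptProb q.2) *
        u (z.1, q.1.1) ∂((stepKernel Φ h γ ^ L) (z, 0)) :=
      measurable_lintegral_kernel_comp (stepKernel Φ h γ ^ L)
        (f := fun z : E d × E d => (z, (0 : ℝ))) (by fun_prop) (hmeas hu)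
    simp_rw [lintegral_maltKernel hΦ _ (hux _)]
    rw [lintegral_add_left (by fun_prop), phaseMeasure, lintegral_prod _ hmz.aemeasurable]
  rw [hpair hu, hpair (u := fun p => u (p.2, p.1)) (hu.comp measurable_swap)]
  congr 1
  -- The velocity flips are invisible here, since `u` sees only positions.
  rw [lintegral_trajectory_reversal hΦ (mul_pos hγ hh).le L (hmeas hu)]
  refine lintegral_congr fun z => lintegral_congr fun q => ?_
  rw [← mul_assoc, ← ENNReal.ofReal_mul (Real.exp_nonneg _), exp_neg_mul_acceptProb_neg]
  rfl

theorem symmetricPair_maltKernel (hΦ : ContDiff ℝ 1 Φ)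
    (hint : Integrable (fun x => Real.exp (-Φ x)) volume) (hγ : 0 < γ) (hh : 0 < h) :
    SymmetricPair (target Φ) (maltKernel Φ h T γ) := by
  have := isMarkovKernel_maltKernel (h := h) (T := T) (γ := γ) hΦ
  have := isProbabilityMeasure_target hΦ hint
  refine Measure.ext_of_lintegral _ fun u hu => ?_
  rw [lintegral_map hu measurable_swap, Measure.lintegral_compProd (f := fun p => u p.swap) (hu.comp measurable_swap),
    Measure.lintegral_compProd hu, target, lintegral_smul_measure, lintegral_smul_measure,
    lintegral_maltKernel_symm hΦ hγ hh hu]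
  rfl

theorem target_absolutelyContinuous_maltKernel (hΦ : ContDiff ℝ 1 Φ) (hγ : 0 < γ) (hh : 0 < h)
    (hT : h ≤ T) (x : E d) : target Φ ≪ maltKernel Φ h T γ x := by
  refine ((target_absolutelyContinuous Φ).trans
    (volume_absolutelyContinuous_acceptedLaw hΦ hγ hh hT x)).trans ?_
  rw [maltKernel_apply hΦ]
  exact (Measure.le_add_left le_rfl).absolutelyContinuous

end Malt

/-! ### Irreducibility, aperiodicity and conclusion -/

/-- A kernel whose transition laws all dominate `π` is `π`-irreducible. -/
theorem isIrreducible_of_absolutelyContinuous {α : Type*} [MeasurableSpace α] {π : Measure α}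
    {κ : Kernel α α} (hac : ∀ x, π ≪ κ x) : IsIrreducible π κ := by
  intro A _ hpos x
  refine ⟨1, one_pos, ?_⟩
  rw [pow_one, pos_iff_ne_zero]
  exact fun h0 => hpos.ne' (hac x h0)

/-- A Markov kernel whose transition laws all dominate `π` is aperiodic. -/
theorem isAperiodic_of_absolutelyContinuous {α : Type*} [MeasurableSpace α] {π : Measure α}
    {κ : Kernel α α} [IsMarkovKernel κ] (hac : ∀ x, π ≪ κ x) : IsAperiodic π κ := by
  rintro ⟨p, hp, S, hS, hdisj, hcyc, hpos⟩
  obtain ⟨x, hx⟩ := nonempty_of_measure_ne_zero hpos.ne'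
  have : Fact (1 < p) := ⟨hp⟩
  -- As `p ≥ 2`, the classes `0` and `1` differ. Domination gives `S 0` positive mass from `x`, on
  -- top of the full mass of `S 1`.
  have hd : Disjoint (S 0) (S (0 + 1)) := hdisj (by simp)
  have h1 : κ x (S 0) ≠ 0 := fun h0 => hpos.ne' (hac x h0)
  have h2 : κ x (S 0) + κ x (S (0 + 1)) ≤ 1 := by
    rw [← measure_union hd (hS _)]
    exact prob_le_one
  rw [hcyc 0 x hx] at h2
  exact (ENNReal.lt_add_right ENNReal.one_ne_top h1).not_ge (add_comm (1 : ENNReal) _ ▸ h2)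

end MALT

theorem mainTheorem9 (d : ℕ) (Φ : MALT.E d → ℝ) (hΦ : ContDiff ℝ 1 Φ)
    (hint : Integrable (fun x => Real.exp (-Φ x)) volume)
    (γ : ℝ) (hγ : 0 < γ) (h T : ℝ) (hh : 0 < h) (hT : h ≤ T) :
    MALT.IsIrreducible (MALT.target Φ) (MALT.maltKernel Φ h T γ) ∧
    MALT.IsAperiodic (MALT.target Φ) (MALT.maltKernel Φ h T γ) ∧
    ∀ᵐ x ∂(MALT.target Φ),
      Tendsto (fun n : ℕ => MALT.tvDist ((MALT.maltKernel Φ h T γ ^ n) x) (MALT.target Φ))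
        atTop (𝓝 0) := by
  have := MALT.isMarkovKernel_maltKernel (h := h) (T := T) (γ := γ) hΦ
  have := MALT.isProbabilityMeasure_target hΦ hint
  have hac := MALT.target_absolutelyContinuous_maltKernel hΦ hγ hh hT
  -- Convergence in fact holds from every starting point.
  refine ⟨MALT.isIrreducible_of_absolutelyContinuous hac,
    MALT.isAperiodic_of_absolutelyContinuous hac, Eventually.of_forall fun x => ?_⟩
  exact MALT.tendsto_tvDist_pow (MALT.symmetricPair_maltKernel hΦ hint hγ hh) hac
    (MALT.rejectProb_lt_one hΦ hγ hh hT x)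
    ((MALT.acceptedLaw_absolutelyContinuous hΦ hγ hh hT x).trans
      (MALT.volume_absolutelyContinuous_target hΦ hint)) (MALT.maltKernel_apply hΦ x)
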